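/- A pseudo double category $\mathbb{D}$ is a pseudo category in $\mathbf{Cat}$: a category $\mathscr{D}_0$ (objects and arrows), a category $\mathscr{D}_1$ (proarrows and cells), functors $\mathsf{src},\mathsf{tgt}\colon\mathscr{D}_1\rightrightarrows\mathscr{D}_0$, $y\colon\mathscr{D}_0\to\mathscr{D}_1$, $\otimes\colon\mathscr{D}_1\times_{\mathscr{D}_0}\mathscr{D}_1\to\mathscr{D}_1$ compatible with source and target, with $\otimes$ strictly unital and associative up to a coherent natural isomorphism whose source and target are identities. A pseudo double functor $F$ consists of functors $F_0,F_1$ strictly preserving source and target together with coherent, natural, invertible cells $\phi\colon FM\otimes FN\cong F(M\otimes N)$ and $\iota\colon y(FX)\cong F(yX)$ with identity source and target; it is strict if all $\phi$ and $\iota$ are identities. A transformation $\alpha\colon F\Rightarrow G$ consists of natural families of arrows $\alpha_X\colon FX\to GX$ and of cells $\alpha_M\colon FM\to GM$, compatible with source and target and with $\iota$ and $\phi$. These form a strict 2-category $\mathbf{Dbl}$. A 1-cell $P\colon E\to B$ of a strict 2-category is an internal fibration if for all 1-cells $e\colon X\to E$, $b\colon X\to B$ and every 2-cell $\beta\colon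 b\Rightarrow Pe$ there are $e'\colon X\to E$ and $\alpha\colon e'\Rightarrow e$ with $Pe'=b$ and $P\alpha=\beta$, such that for all $x\colon Y\to X$, $e''\colon Y\to E$, $\xi\colon e''\Rightarrow ex$ and $\gamma\colon Pe''\Rightarrow Pe'x$ with $P\xi=(P\alpha x)\cdot\gamma$ there is a unique $\zeta\colon e''\Rightarrow e'x$ with $(\alpha x)\cdot\zeta=\xi$ and $P\zeta=\gamma$. A strict double functor $P\colon\mathbb{E}\to\mathbb{B}$ between pseudo double categories is said to define a double fibration if $P_0\colon\mathscr{E}_0\to\mathscr{B}_0$ and $P_1\colon\mathscr{E}_1\to\mathscr{B}_1$ are (Grothendieck) fibrations; there exist cleavages of $P_0$ and of $P_1$ such that both $\mathsf{src}$ and $\mathsf{tgt}\colon\mathscr{E}_1\to\mathscr{E}_0$ map the chosen Cartesian lifts of $P_1$ to the chosen Cartesian lifts of $P_0$; and $y\colon\mathscr{E}_0\to\mathscr{E}_1$ and $\otimes\colon\mathscr{E}_1\times_{\mathscr{E}_0}\mathscr{E}_1\to\mathscr{E}_1$ map Cartesian arrows (with respect to $P_0$, respectively $P_1\times_{P_0}P_1$)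 to arrows that are Cartesian with respect to $P_1$. Theorem. A strict double functor $P\colon\mathbb{E}\to\mathbb{B}$ between pseudo double categories defines a double fibration if and only if it is an internal fibration in the 2-category $\mathbf{Dbl}$. -/

import Mathlib

open CategoryTheory

universe v u

namespace DblFib

/-! ### Pseudo double categories -/

/-- The objects of the category of arrows `C₁` of a double category with objects `O`:
a proarrow `pro : src ⇸ tgt` together with its source and its target. -/
structure ProArrow {O : Type u} (Pro : O → O → Type u) : Type u where
  src : O
  tgt : O
  pro : Pro src tgt

/-- A proarrow `m : A ⇸ B`, as an object of the category of arrows. -/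
abbrev ProArrow.of {O : Type u} {Pro : O → O → Type u} {A B : O} (m : Pro A B) :
    ProArrow Pro := ⟨A, B, m⟩

/-- A (normalized) pseudo double category, that is, a pseudo category in `Cat` with strict units.

`Obj` is the category of objects and (vertical) arrows; `ProArrow Pro` is the category of proarrows
and cells; `left` and `right` are the source and target functors on cells; `unitPro`, `unitMap`
form the functor `y`, and `comp`, `compMap` form the functor `⊗`, defined on pairs of cells `θ`, `κ`
that are composable, i.e. such that `right θ = left κ`. -/
structure Dbl : Type (max (u + 1) (v + 1)) where
  Obj : Type u
  [catObj : Category.{v} Obj]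
  Pro : Obj → Obj → Type u
  [catPro : Category.{v} (ProArrow Pro)]
  -- source and target functors
  left {m n : ProArrow Pro} (θ : m ⟶ n) : m.src ⟶ n.src
  right {m n : ProArrow Pro} (θ : m ⟶ n) : m.tgt ⟶ n.tgt
  left_id (m : ProArrow Pro) : left (𝟙 m) = 𝟙 m.src
  right_id (m : ProArrow Pro) : right (𝟙 m) = 𝟙 m.tgt
  left_comp {m n p : ProArrow Pro} (θ : m ⟶ n) (κ : n ⟶ p) : left (θ ≫ κ) = left θ ≫ left κ
  right_comp {m n p : ProArrow Pro} (θ : m ⟶ n) (κ : n ⟶ p) :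
    right (θ ≫ κ) = right θ ≫ right κ
  -- the unit functor `y`, a common section of source and target
  unitPro (A : Obj) : Pro A A
  unitMap {A B : Obj} (f : A ⟶ B) : ProArrow.of (unitPro A) ⟶ ProArrow.of (unitPro B)
  left_unitMap {A B : Obj} (f : A ⟶ B) : left (unitMap f) = f
  right_unitMap {A B : Obj} (f : A ⟶ B) : right (unitMap f) = f
  unitMap_id (A : Obj) : unitMap (𝟙 A) = 𝟙 _
  unitMap_comp {A B C : Obj} (f : A ⟶ B) (g : B ⟶ C) : unitMap (f ≫ g) = unitMap f ≫ unitMap g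
  -- the external composition functor `⊗`
  comp {A B C : Obj} (m : Pro A B) (n : Pro B C) : Pro A C
  compMap {A B C A' B' C' : Obj} {m : Pro A B} {n : Pro B C} {m' : Pro A' B'} {n' : Pro B' C'}
    (θ : ProArrow.of m ⟶ ProArrow.of m') (κ : ProArrow.of n ⟶ ProArrow.of n')
    (h : right θ = left κ) : ProArrow.of (comp m n) ⟶ ProArrow.of (comp m' n')
  left_compMap {A B C A' B' C' : Obj} {m : Pro A B} {n : Pro B C} {m' : Pro A' B'}
    {n' : Pro B' C'} (θ : ProArrow.of m ⟶ ProArrow.of m')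
    (κ : ProArrow.of n ⟶ ProArrow.of n') (h : right θ = left κ) :
    left (compMap θ κ h) = left θ
  right_compMap {A B C A' B' C' : Obj} {m : Pro A B} {n : Pro B C} {m' : Pro A' B'}
    {n' : Pro B' C'} (θ : ProArrow.of m ⟶ ProArrow.of m')
    (κ : ProArrow.of n ⟶ ProArrow.of n') (h : right θ = left κ) :
    right (compMap θ κ h) = right κ
  compMap_id {A B C : Obj} (m : Pro A B) (n : Pro B C) :
    compMap (𝟙 (ProArrow.of m)) (𝟙 (ProArrow.of n))
      ((right_id (ProArrow.of m)).trans (left_id (ProArrow.of n)).symm) = 𝟙 _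
  compMap_comp {A B C A' B' C' A'' B'' C'' : Obj} {m : Pro A B} {n : Pro B C} {m' : Pro A' B'}
    {n' : Pro B' C'} {m'' : Pro A'' B''} {n'' : Pro B'' C''}
    (θ : ProArrow.of m ⟶ ProArrow.of m') (κ : ProArrow.of n ⟶ ProArrow.of n')
    (θ' : ProArrow.of m' ⟶ ProArrow.of m'') (κ' : ProArrow.of n' ⟶ ProArrow.of n'')
    (h : right θ = left κ) (h' : right θ' = left κ') :
    compMap (θ ≫ θ') (κ ≫ κ') (by rw [right_comp, left_comp, h, h']) =
      compMap θ κ h ≫ compMap θ' κ' h'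
  -- the associator, a natural isomorphism with trivial source and target
  assoc {A B C D : Obj} (m : Pro A B) (n : Pro B C) (p : Pro C D) :
    ProArrow.of (comp (comp m n) p) ≅ ProArrow.of (comp m (comp n p))
  left_assoc {A B C D : Obj} (m : Pro A B) (n : Pro B C) (p : Pro C D) :
    left (assoc m n p).hom = 𝟙 A
  right_assoc {A B C D : Obj} (m : Pro A B) (n : Pro B C) (p : Pro C D) :
    right (assoc m n p).hom = 𝟙 D
  assoc_naturality {A B C D A' B' C' D' : Obj} {m : Pro A B} {n : Pro B C} {p : Pro C D}
    {m' : Pro A' B'} {n' : Pro B' C'} {p' : Pro C' D'}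
    (θ : ProArrow.of m ⟶ ProArrow.of m') (κ : ProArrow.of n ⟶ ProArrow.of n')
    (ρ : ProArrow.of p ⟶ ProArrow.of p') (h : right θ = left κ) (k : right κ = left ρ) :
    compMap (compMap θ κ h) ρ ((right_compMap θ κ h).trans k) ≫ (assoc m' n' p').hom =
      (assoc m n p).hom ≫ compMap θ (compMap κ ρ k) (h.trans (left_compMap κ ρ k).symm)
  pentagon {A B C D E : Obj} (m : Pro A B) (n : Pro B C) (p : Pro C D) (q : Pro D E) :
    compMap (assoc m n p).hom (𝟙 (ProArrow.of q))
        ((right_assoc m n p).trans (left_id (ProArrow.of q)).symm) ≫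
      (assoc m (comp n p) q).hom ≫
      compMap (𝟙 (ProArrow.of m)) (assoc n p q).hom
        ((right_id (ProArrow.of m)).trans (left_assoc n p q).symm) =
    (assoc (comp m n) p q).hom ≫ (assoc m n (comp p q)).hom
  -- normalization: the unitors are identities
  unit_comp {A B : Obj} (m : Pro A B) : comp (unitPro A) m = m
  comp_unit {A B : Obj} (m : Pro A B) : comp m (unitPro B) = m
  unit_compMap {A B A' B' : Obj} {m : Pro A B} {m' : Pro A' B'}
    (θ : ProArrow.of m ⟶ ProArrow.of m') :
    compMap (unitMap (left θ)) θ (right_unitMap _) ≫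
        eqToHom (congrArg ProArrow.of (unit_comp m')) =
      eqToHom (congrArg ProArrow.of (unit_comp m)) ≫ θ
  compMap_unit {A B A' B' : Obj} {m : Pro A B} {m' : Pro A' B'}
    (θ : ProArrow.of m ⟶ ProArrow.of m') :
    compMap θ (unitMap (right θ)) (left_unitMap _).symm ≫
        eqToHom (congrArg ProArrow.of (comp_unit m')) =
      eqToHom (congrArg ProArrow.of (comp_unit m)) ≫ θ
  -- the triangle axiom
  triangle {A B C : Obj} (m : Pro A B) (n : Pro B C) :
    (assoc m (unitPro B) n).hom = eqToHom (congrArg ProArrow.of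
      ((congrArg (fun k => comp k n) (comp_unit m)).trans
        (congrArg (comp m) (unit_comp n)).symm))

attribute [instance] Dbl.catObj Dbl.catPro

namespace Dbl

attribute [simp] left_id right_id left_comp right_comp left_unitMap right_unitMap unitMap_id
  left_compMap right_compMap compMap_id left_assoc right_assoc

/-- The category of proarrows and cells. -/
abbrev Arr (C : Dbl.{v, u}) : Type u := ProArrow C.Pro

/-- The source functor. -/
@[simps] def srcFunctor (C : Dbl.{v, u}) : C.Arr ⥤ C.Obj where
  obj m := m.src
  map θ := C.left θ

/-- The target functor. -/
@[simps] def tgtFunctor (C : Dbl.{v, u}) : C.Arr ⥤ C.Obj where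
  obj m := m.tgt
  map θ := C.right θ

/-- The unit functor `y`. -/
@[simps] def unitFunctor (C : Dbl.{v, u}) : C.Obj ⥤ C.Arr where
  obj A := ProArrow.of (C.unitPro A)
  map f := C.unitMap f
  map_comp := C.unitMap_comp

/-- Objects of the pullback `C₁ ×_{C₀} C₁` (target of the first component equal to the source of
the second one): composable pairs of proarrows. -/
structure Pair (C : Dbl.{v, u}) : Type u where
  {A B D : C.Obj}
  fst : C.Pro A B
  snd : C.Pro B D

/-- Arrows of the pullback `C₁ ×_{C₀} C₁`: composable pairs of cells. -/
@[ext] structure Pair.Hom {C : Dbl.{v, u}} (x y : C.Pair) : Type v where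
  fst : ProArrow.of x.fst ⟶ ProArrow.of y.fst
  snd : ProArrow.of x.snd ⟶ ProArrow.of y.snd
  w : C.right fst = C.left snd

@[simps] instance (C : Dbl.{v, u}) : Category.{v} C.Pair where
  Hom := Pair.Hom
  id _ := ⟨𝟙 _, 𝟙 _, by simp⟩
  comp f g := ⟨f.fst ≫ g.fst, f.snd ≫ g.snd, by simp [f.w, g.w]⟩

/-- The external composition functor `⊗ : C₁ ×_{C₀} C₁ ⥤ C₁`. -/
@[simps] def compFunctor (C : Dbl.{v, u}) : C.Pair ⥤ C.Arr where
  obj x := ProArrow.of (C.comp x.fst x.snd)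
  map f := C.compMap f.fst f.snd f.w
  map_id x := C.compMap_id _ _
  map_comp f g := C.compMap_comp _ _ _ _ f.w g.w

lemma compMap_congr (C : Dbl.{v, u}) {A B D A' B' D' : C.Obj} {m : C.Pro A B} {n : C.Pro B D}
    {m' : C.Pro A' B'} {n' : C.Pro B' D'} {θ θ' : ProArrow.of m ⟶ ProArrow.of m'}
    {κ κ' : ProArrow.of n ⟶ ProArrow.of n'} (h : C.right θ = C.left κ) (e : θ = θ')
    (e' : κ = κ') : C.compMap θ κ h = C.compMap θ' κ' (by rw [← e, ← e', h]) := by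
  subst e e'; rfl

end Dbl

/-! ### Pseudo double functors -/

/-- A pseudo double functor: functors on objects/arrows and on proarrows/cells that strictly
preserve source and target, with globular invertible natural comparisons
`φ : F m ⊗ F n ≅ F (m ⊗ n)` and `ι : y (F A) ≅ F (y A)`, subject to the associativity and unit
coherence axioms. -/
@[ext] structure PseudoDoubleFunctor (C D : Dbl.{v, u}) : Type (max u v) where
  obj : C.Obj → D.Obj
  map {A B : C.Obj} (f : A ⟶ B) : obj A ⟶ obj B
  map_id (A : C.Obj) : map (𝟙 A) = 𝟙 (obj A)
  map_comp {A B E : C.Obj} (f : A ⟶ B) (g : B ⟶ E) : map (f ≫ g) = map f ≫ map g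
  pro {A B : C.Obj} (m : C.Pro A B) : D.Pro (obj A) (obj B)
  cell {m n : C.Arr} (θ : m ⟶ n) : ProArrow.of (pro m.pro) ⟶ ProArrow.of (pro n.pro)
  cell_id (m : C.Arr) : cell (𝟙 m) = 𝟙 _
  cell_comp {m n p : C.Arr} (θ : m ⟶ n) (κ : n ⟶ p) : cell (θ ≫ κ) = cell θ ≫ cell κ
  left_cell {m n : C.Arr} (θ : m ⟶ n) : D.left (cell θ) = map (C.left θ)
  right_cell {m n : C.Arr} (θ : m ⟶ n) : D.right (cell θ) = map (C.right θ)
  φ {A B E : C.Obj} (m : C.Pro A B) (n : C.Pro B E) :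
    ProArrow.of (D.comp (pro m) (pro n)) ≅ ProArrow.of (pro (C.comp m n))
  left_φ {A B E : C.Obj} (m : C.Pro A B) (n : C.Pro B E) : D.left (φ m n).hom = 𝟙 _
  right_φ {A B E : C.Obj} (m : C.Pro A B) (n : C.Pro B E) : D.right (φ m n).hom = 𝟙 _
  φ_naturality {A B E A' B' E' : C.Obj} {m : C.Pro A B} {n : C.Pro B E} {m' : C.Pro A' B'}
    {n' : C.Pro B' E'} (θ : ProArrow.of m ⟶ ProArrow.of m')
    (κ : ProArrow.of n ⟶ ProArrow.of n') (h : C.right θ = C.left κ) :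
    D.compMap (cell θ) (cell κ) (by rw [right_cell, left_cell, h]) ≫ (φ m' n').hom =
      (φ m n).hom ≫ cell (C.compMap θ κ h)
  ι (A : C.Obj) : ProArrow.of (D.unitPro (obj A)) ≅ ProArrow.of (pro (C.unitPro A))
  left_ι (A : C.Obj) : D.left (ι A).hom = 𝟙 _
  right_ι (A : C.Obj) : D.right (ι A).hom = 𝟙 _
  ι_naturality {A B : C.Obj} (f : A ⟶ B) :
    D.unitMap (map f) ≫ (ι B).hom = (ι A).hom ≫ cell (C.unitMap f)
  associativity {A B E K : C.Obj} (m : C.Pro A B) (n : C.Pro B E) (p : C.Pro E K) :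
    D.compMap (φ m n).hom (𝟙 (ProArrow.of (pro p)))
        ((right_φ m n).trans (D.left_id (ProArrow.of (pro p))).symm) ≫
      (φ (C.comp m n) p).hom ≫ cell (C.assoc m n p).hom =
    (D.assoc (pro m) (pro n) (pro p)).hom ≫
      D.compMap (𝟙 (ProArrow.of (pro m))) (φ n p).hom
        ((D.right_id (ProArrow.of (pro m))).trans (left_φ n p).symm) ≫
      (φ m (C.comp n p)).hom
  left_unitality {A B : C.Obj} (m : C.Pro A B) :
    D.compMap (ι A).hom (𝟙 (ProArrow.of (pro m)))
        ((right_ι A).trans (D.left_id (ProArrow.of (pro m))).symm) ≫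
      (φ (C.unitPro A) m).hom ≫ cell (eqToHom (congrArg ProArrow.of (C.unit_comp m))) =
    eqToHom (congrArg ProArrow.of (D.unit_comp (pro m)))
  right_unitality {A B : C.Obj} (m : C.Pro A B) :
    D.compMap (𝟙 (ProArrow.of (pro m))) (ι B).hom
        ((D.right_id (ProArrow.of (pro m))).trans (left_ι B).symm) ≫
      (φ m (C.unitPro B)).hom ≫ cell (eqToHom (congrArg ProArrow.of (C.comp_unit m))) =
    eqToHom (congrArg ProArrow.of (D.comp_unit (pro m)))

namespace PseudoDoubleFunctor

attribute [simp] map_id map_comp cell_id cell_comp left_cell right_cell left_φ right_φ left_ι right_ι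

variable {C D E K : Dbl.{v, u}}

/-- The functor on categories of objects and arrows. -/
@[simps] def objFunctor (F : PseudoDoubleFunctor C D) : C.Obj ⥤ D.Obj where
  obj A := F.obj A
  map f := F.map f

/-- The functor on categories of proarrows and cells. -/
@[simps] def arrFunctor (F : PseudoDoubleFunctor C D) : C.Arr ⥤ D.Arr where
  obj m := ProArrow.of (F.pro m.pro)
  map θ := F.cell θ

/-- The functor `F₁ ×_{F₀} F₁ : C₁ ×_{C₀} C₁ ⥤ D₁ ×_{D₀} D₁`. -/
@[simps] def pairFunctor (F : PseudoDoubleFunctor C D) : C.Pair ⥤ D.Pair where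
  obj x := ⟨F.pro x.fst, F.pro x.snd⟩
  map f := ⟨F.cell f.fst, F.cell f.snd, by simp [f.w]⟩

/-- A strict double functor: the comparison cells are identities (so in particular units and
external composites are preserved on the nose). -/
structure IsStrict (F : PseudoDoubleFunctor C D) : Prop where
  pro_comp {A B E : C.Obj} (m : C.Pro A B) (n : C.Pro B E) :
    D.comp (F.pro m) (F.pro n) = F.pro (C.comp m n)
  φ_eq {A B E : C.Obj} (m : C.Pro A B) (n : C.Pro B E) :
    (F.φ m n).hom = eqToHom (congrArg ProArrow.of (pro_comp m n))
  pro_unit (A : C.Obj) : D.unitPro (F.obj A) = F.pro (C.unitPro A)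
  ι_eq (A : C.Obj) : (F.ι A).hom = eqToHom (congrArg ProArrow.of (pro_unit A))

/-- The identity double functor. -/
protected abbrev id (C : Dbl.{v, u}) : PseudoDoubleFunctor C C where
  obj A := A
  map f := f
  map_id _ := rfl
  map_comp _ _ := rfl
  pro m := m
  cell θ := θ
  cell_id _ := rfl
  cell_comp _ _ := rfl
  left_cell _ := rfl
  right_cell _ := rfl
  φ _ _ := Iso.refl _
  left_φ _ _ := by simp
  right_φ _ _ := by simp
  φ_naturality _ _ _ := by simp
  ι _ := Iso.refl _
  left_ι _ := by simp
  right_ι _ := by simp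
  ι_naturality _ := by simp
  associativity m n p := by simp
  left_unitality m := by simp
  right_unitality m := by simp

lemma cell_eqToHom (F : PseudoDoubleFunctor C D) {A B : C.Obj} {m n : C.Pro A B} (h : m = n) :
    F.cell (eqToHom (congrArg ProArrow.of h)) =
      eqToHom (congrArg (fun k => ProArrow.of (F.pro k)) h) := by
  subst h; simp

/-- The image of an invertible cell. -/
@[simps] def cellIso (F : PseudoDoubleFunctor C D) {m n : C.Arr} (θ : m ≅ n) :
    ProArrow.of (F.pro m.pro) ≅ ProArrow.of (F.pro n.pro) where
  hom := F.cell θ.hom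
  inv := F.cell θ.inv
  hom_inv_id := by rw [← cell_comp, θ.hom_inv_id, cell_id]
  inv_hom_id := by rw [← cell_comp, θ.inv_hom_id, cell_id]

/-- Composition of pseudo double functors. -/
protected abbrev comp (F : PseudoDoubleFunctor C D) (G : PseudoDoubleFunctor D E) :
    PseudoDoubleFunctor C E where
  obj A := G.obj (F.obj A)
  map f := G.map (F.map f)
  map_id _ := by simp
  map_comp _ _ := by simp
  pro m := G.pro (F.pro m)
  cell θ := G.cell (F.cell θ)
  cell_id m := by simp
  cell_comp θ κ := by simp
  left_cell θ := by simp
  right_cell θ := by simp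
  φ m n := G.φ (F.pro m) (F.pro n) ≪≫ G.cellIso (F.φ m n)
  left_φ m n := by simp
  right_φ m n := by simp
  φ_naturality θ κ h := by
    simp only [Iso.trans_hom, cellIso_hom, Category.assoc]
    rw [reassoc_of% (G.φ_naturality (F.cell θ) (F.cell κ) (by simp [h])), ← cell_comp,
      F.φ_naturality θ κ h, cell_comp]
  ι A := G.ι (F.obj A) ≪≫ G.cellIso (F.ι A)
  left_ι A := by simp
  right_ι A := by simp
  ι_naturality f := by
    simp only [Iso.trans_hom, cellIso_hom, Category.assoc]
    rw [reassoc_of% (G.ι_naturality (F.map f)), ← cell_comp, F.ι_naturality f,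
      cell_comp]
  associativity m n p := by
    have h := congrArg (fun θ => G.cell θ) (F.associativity m n p)
    simp only [cell_comp] at h
    have e₁ := G.φ_naturality (F.φ m n).hom (𝟙 (ProArrow.of (F.pro p))) (by simp)
    have e₂ := G.φ_naturality (𝟙 (ProArrow.of (F.pro m))) (F.φ n p).hom (by simp)
    have a := G.associativity (F.pro m) (F.pro n) (F.pro p)
    have c₁ := E.compMap_comp (G.φ (F.pro m) (F.pro n)).hom (𝟙 (ProArrow.of (G.pro (F.pro p))))
      (G.cell (F.φ m n).hom) (𝟙 (ProArrow.of (G.pro (F.pro p)))) (by simp) (by simp)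
    have c₂ := E.compMap_comp (𝟙 (ProArrow.of (G.pro (F.pro m)))) (G.φ (F.pro n) (F.pro p)).hom
      (𝟙 (ProArrow.of (G.pro (F.pro m)))) (G.cell (F.φ n p).hom) (by simp) (by simp)
    simp only [Category.comp_id, cell_id] at c₁ c₂ e₁ e₂
    simp only [Iso.trans_hom, cellIso_hom, Category.assoc]
    rw [c₁, c₂]
    simp only [Category.assoc]
    rw [reassoc_of% e₁, h, reassoc_of% a, reassoc_of% e₂]
  left_unitality {A B} m := by
    have h := congrArg (fun θ => G.cell θ) (F.left_unitality m)
    simp only [cell_comp] at h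
    have e := G.φ_naturality (F.ι A).hom (𝟙 (ProArrow.of (F.pro m))) (by simp)
    have c := E.compMap_comp (G.ι (F.obj A)).hom (𝟙 (ProArrow.of (G.pro (F.pro m))))
      (G.cell (F.ι A).hom) (𝟙 (ProArrow.of (G.pro (F.pro m)))) (by simp) (by simp)
    simp only [Category.comp_id, cell_id] at c e
    simp only [Iso.trans_hom, cellIso_hom, Category.assoc]
    rw [c]
    simp only [Category.assoc]
    rw [reassoc_of% e, h, G.left_unitality]
  right_unitality {A B} m := by
    have h := congrArg (fun θ => G.cell θ) (F.right_unitality m)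
    simp only [cell_comp] at h
    have e := G.φ_naturality (𝟙 (ProArrow.of (F.pro m))) (F.ι B).hom (by simp)
    have c := E.compMap_comp (𝟙 (ProArrow.of (G.pro (F.pro m)))) (G.ι (F.obj B)).hom
      (𝟙 (ProArrow.of (G.pro (F.pro m)))) (G.cell (F.ι B).hom) (by simp) (by simp)
    simp only [Category.comp_id, cell_id] at c e
    simp only [Iso.trans_hom, cellIso_hom, Category.assoc]
    rw [c]
    simp only [Category.assoc]
    rw [reassoc_of% e, h, G.right_unitality]

protected lemma id_comp (F : PseudoDoubleFunctor C D) :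
    (PseudoDoubleFunctor.id C).comp F = F := by
  refine PseudoDoubleFunctor.ext rfl HEq.rfl HEq.rfl HEq.rfl (heq_of_eq ?_) (heq_of_eq ?_)
  · funext _ _ _ m n; ext; simp
  · funext A; ext; simp

protected lemma comp_id (F : PseudoDoubleFunctor C D) :
    F.comp (PseudoDoubleFunctor.id D) = F := by
  refine PseudoDoubleFunctor.ext rfl HEq.rfl HEq.rfl HEq.rfl (heq_of_eq ?_) (heq_of_eq ?_)
  · funext _ _ _ m n; ext; simp
  · funext A; ext; simp

protected lemma assoc (F : PseudoDoubleFunctor C D) (G : PseudoDoubleFunctor D E)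
    (H : PseudoDoubleFunctor E K) : (F.comp G).comp H = F.comp (G.comp H) := by
  refine PseudoDoubleFunctor.ext rfl HEq.rfl HEq.rfl HEq.rfl (heq_of_eq ?_) (heq_of_eq ?_)
  · funext _ _ _ m n; ext; simp
  · funext A; ext; simp

end PseudoDoubleFunctor

/-! ### Transformations -/

/-- A (vertical) transformation between pseudo double functors. -/
@[ext] structure Transformation {C D : Dbl.{v, u}} (F G : PseudoDoubleFunctor C D) :
    Type (max u v) where
  app (A : C.Obj) : F.obj A ⟶ G.obj A
  appPro {A B : C.Obj} (m : C.Pro A B) : ProArrow.of (F.pro m) ⟶ ProArrow.of (G.pro m)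
  left_appPro {A B : C.Obj} (m : C.Pro A B) : D.left (appPro m) = app A
  right_appPro {A B : C.Obj} (m : C.Pro A B) : D.right (appPro m) = app B
  naturality {A B : C.Obj} (f : A ⟶ B) :
    F.map f ≫ app B = app A ≫ G.map f
  naturality_cell {m n : C.Arr} (θ : m ⟶ n) :
    F.cell θ ≫ appPro n.pro = appPro m.pro ≫ G.cell θ
  unit (A : C.Obj) :
    D.unitMap (app A) ≫ (G.ι A).hom = (F.ι A).hom ≫ appPro (C.unitPro A)
  comp {A B E : C.Obj} (m : C.Pro A B) (n : C.Pro B E) :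
    D.compMap (appPro m) (appPro n) ((right_appPro m).trans (left_appPro n).symm) ≫
      (G.φ m n).hom = (F.φ m n).hom ≫ appPro (C.comp m n)

namespace Transformation

attribute [simp] left_appPro right_appPro

variable {C D E : Dbl.{v, u}}

/-- The identity transformation. -/
@[simps] protected def id (F : PseudoDoubleFunctor C D) : Transformation F F where
  app _ := 𝟙 _
  appPro _ := 𝟙 _
  left_appPro _ := by simp
  right_appPro _ := by simp
  naturality _ := by simp
  naturality_cell _ := by simp
  unit _ := by simp
  comp _ _ := by simp

/-- Composition of transformations. -/
@[simps] protected def vcomp {F G H : PseudoDoubleFunctor C D} (α : Transformation F G)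
    (β : Transformation G H) : Transformation F H where
  app A := α.app A ≫ β.app A
  appPro m := α.appPro m ≫ β.appPro m
  left_appPro _ := by simp
  right_appPro _ := by simp
  naturality f := by rw [reassoc_of% α.naturality f, β.naturality f, Category.assoc]
  naturality_cell θ := by
    rw [reassoc_of% α.naturality_cell θ, β.naturality_cell θ, Category.assoc]
  unit A := by
    rw [D.unitMap_comp, Category.assoc, β.unit, reassoc_of% α.unit A]
  comp m n := by
    rw [D.compMap_comp _ _ _ _ (by simp) (by simp), Category.assoc, β.comp,
      reassoc_of% α.comp m n]

instance : Category.{max u v} (PseudoDoubleFunctor C D) where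
  Hom F G := Transformation F G
  id F := Transformation.id F
  comp α β := Transformation.vcomp α β
  id_comp _ := by ext <;> simp
  comp_id _ := by ext <;> simp
  assoc _ _ _ := by ext <;> simp

@[simp] lemma idTrans_app (F : PseudoDoubleFunctor C D) (A : C.Obj) :
    Transformation.app (𝟙 F) A = 𝟙 _ := rfl

@[simp] lemma idTrans_appPro (F : PseudoDoubleFunctor C D) {A B : C.Obj} (m : C.Pro A B) :
    Transformation.appPro (𝟙 F) m = 𝟙 _ := rfl

@[simp] lemma comp_app {F G H : PseudoDoubleFunctor C D} (α : F ⟶ G) (β : G ⟶ H) (A : C.Obj) :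
    Transformation.app (α ≫ β) A = Transformation.app α A ≫ Transformation.app β A := rfl

@[simp] lemma comp_appPro {F G H : PseudoDoubleFunctor C D} (α : F ⟶ G) (β : G ⟶ H)
    {A B : C.Obj} (m : C.Pro A B) :
    Transformation.appPro (α ≫ β) m = Transformation.appPro α m ≫ Transformation.appPro β m :=
  rfl

@[ext] lemma hom_ext {F G : PseudoDoubleFunctor C D} {α β : F ⟶ G}
    (h : ∀ A, Transformation.app α A = Transformation.app β A)
    (h' : ∀ {A B : C.Obj} (m : C.Pro A B),
      Transformation.appPro α m = Transformation.appPro β m) : α = β :=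
  Transformation.ext (funext h) (by funext A B m; exact h' m)

/-- Whiskering `α E` of a transformation with a pseudo double functor applied first. -/
@[simps] def whiskerLeft (F : PseudoDoubleFunctor C D) {G H : PseudoDoubleFunctor D E}
    (α : Transformation G H) : Transformation (F.comp G) (F.comp H) where
  app A := α.app (F.obj A)
  appPro m := α.appPro (F.pro m)
  left_appPro _ := by simp
  right_appPro _ := by simp
  naturality f := α.naturality _
  naturality_cell θ := α.naturality_cell (F.cell θ)
  unit A := by
    have h := α.naturality_cell (F.ι A).hom
    simp only [Iso.trans_hom, PseudoDoubleFunctor.cellIso_hom,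
      Category.assoc]
    rw [reassoc_of% α.unit, h]
  comp m n := by
    have h := α.naturality_cell (F.φ m n).hom
    simp only [Iso.trans_hom, PseudoDoubleFunctor.cellIso_hom,
      Category.assoc]
    rw [reassoc_of% α.comp, h]

/-- Whiskering `H α` of a transformation with a pseudo double functor applied last. -/
@[simps] def whiskerRight {F G : PseudoDoubleFunctor C D} (α : Transformation F G)
    (H : PseudoDoubleFunctor D E) : Transformation (F.comp H) (G.comp H) where
  app A := H.map (α.app A)
  appPro m := H.cell (α.appPro m)
  left_appPro _ := by simp
  right_appPro _ := by simp
  naturality f := by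
    simp only [← PseudoDoubleFunctor.map_comp, α.naturality]
  naturality_cell θ := by
    simp only [← PseudoDoubleFunctor.cell_comp,
      α.naturality_cell]
  unit A := by
    simp only [Iso.trans_hom, PseudoDoubleFunctor.cellIso_hom,
      Category.assoc]
    rw [reassoc_of% (H.ι_naturality (α.app A)), ← H.cell_comp, α.unit, H.cell_comp]
  comp m n := by
    simp only [Iso.trans_hom, PseudoDoubleFunctor.cellIso_hom,
      Category.assoc]
    rw [reassoc_of% (H.φ_naturality (α.appPro m) (α.appPro n) (by simp)), ← H.cell_comp, α.comp, H.cell_comp]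

/-- The components of the transformation given by an equality of double functors. -/
lemma eqToHom_app {F G : PseudoDoubleFunctor C D} (h : F = G) (A : C.Obj) :
    Transformation.app (eqToHom h) A = eqToHom (by rw [h]) := by
  subst h; rfl

lemma eqToHom_appPro {F G : PseudoDoubleFunctor C D} (h : F = G) {A B : C.Obj}
    (m : C.Pro A B) :
    Transformation.appPro (eqToHom h) m = eqToHom (by rw [h]) := by
  subst h; rfl

end Transformation

/-! ### The strict 2-category of pseudo double categories -/

/-- Pseudo double categories, pseudo double functors and transformations. -/
instance : Bicategory.{max u v, max u v} Dbl.{v, u} where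
  Hom C D := PseudoDoubleFunctor C D
  id C := PseudoDoubleFunctor.id C
  comp F G := PseudoDoubleFunctor.comp F G
  whiskerLeft F _ _ α := Transformation.whiskerLeft F α
  whiskerRight α H := Transformation.whiskerRight α H
  associator F G H := eqToIso (PseudoDoubleFunctor.assoc F G H)
  leftUnitor F := eqToIso (PseudoDoubleFunctor.id_comp F)
  rightUnitor F := eqToIso (PseudoDoubleFunctor.comp_id F)
  whiskerLeft_id _ _ := by ext <;> simp
  whiskerLeft_comp _ _ _ _ _ _ := by ext <;> simp
  id_whiskerLeft _ := by ext <;> simp [Transformation.eqToHom_app, Transformation.eqToHom_appPro]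
  comp_whiskerLeft _ _ _ _ _ := by ext <;> simp [Transformation.eqToHom_app, Transformation.eqToHom_appPro]
  id_whiskerRight _ _ := by ext <;> simp
  comp_whiskerRight _ _ _ := by ext <;> simp
  whiskerRight_id _ := by ext <;> simp [Transformation.eqToHom_app, Transformation.eqToHom_appPro]
  whiskerRight_comp _ _ _ := by ext <;> simp [Transformation.eqToHom_app, Transformation.eqToHom_appPro]
  whisker_assoc _ _ _ _ _ := by ext <;> simp [Transformation.eqToHom_app, Transformation.eqToHom_appPro]
  whisker_exchange η θ := by
    ext
    · exact (Transformation.naturality θ (Transformation.app η _)).symm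
    · exact (Transformation.naturality_cell θ (Transformation.appPro η _)).symm
  pentagon _ _ _ _ := by ext <;> simp [Transformation.eqToHom_app, Transformation.eqToHom_appPro]
  triangle _ _ := by ext <;> simp [Transformation.eqToHom_app, Transformation.eqToHom_appPro]

/-- The 2-category `Dbl` is strict. -/
instance : Bicategory.Strict Dbl.{v, u} where
  id_comp F := PseudoDoubleFunctor.id_comp F
  comp_id F := PseudoDoubleFunctor.comp_id F
  assoc F G H := PseudoDoubleFunctor.assoc F G H
  leftUnitor_eqToIso _ := rfl
  rightUnitor_eqToIso _ := rfl
  associator_eqToIso _ _ _ := rfl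

/-! ### Internal fibrations in a strict 2-category -/

open Bicategory in
/-- A 1-cell `P : E ⟶ B` of a (strict) 2-category is an internal fibration if every 2-cell
`β : b ⟶ e ≫ P` has a lift `α : e' ⟶ e` with `e' ≫ P = b` and `α ▷ P = β` that is Cartesian:
for every `x : Y ⟶ X`, every `ξ : e'' ⟶ x ≫ e` whose image under `P` factors as
`e'' ≫ P --γ--> x ≫ e' ≫ P --> x ≫ e ≫ P` factors uniquely through `x ◁ α` by
a 2-cell `ζ` whose image is `γ`. The associators below are identities (equalities of 1-cells). -/
def IsInternalFibration {𝒦 : Type*} [Bicategory 𝒦] [Bicategory.Strict 𝒦] {E B : 𝒦}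
    (P : E ⟶ B) : Prop :=
  ∀ ⦃X : 𝒦⦄ (e : X ⟶ E) (b : X ⟶ B) (β : b ⟶ e ≫ P),
    ∃ (e' : X ⟶ E) (α : e' ⟶ e) (h : e' ≫ P = b), α ▷ P = eqToHom h ≫ β ∧
      ∀ ⦃Y : 𝒦⦄ (x : Y ⟶ X) (e'' : Y ⟶ E) (ξ : e'' ⟶ x ≫ e) (γ : e'' ≫ P ⟶ x ≫ e' ≫ P),
        ξ ▷ P = γ ≫ x ◁ (α ▷ P) ≫ (α_ x e P).inv →
          ∃! ζ : e'' ⟶ x ≫ e', ζ ≫ x ◁ α = ξ ∧ ζ ▷ P ≫ (α_ x e' P).hom = γ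

/-! ### Double fibrations -/

section Fibrations

universe v₁ v₂ v₃ v₄ u₁ u₂ u₃ u₄

variable {𝒳 : Type u₁} [Category.{v₁} 𝒳] {𝒮 : Type u₂} [Category.{v₂} 𝒮]
  {𝒳' : Type u₃} [Category.{v₃} 𝒳'] {𝒮' : Type u₄} [Category.{v₄} 𝒮']

/-- An arrow of the domain of `p` is Cartesian with respect to `p` (in the strong sense:
it has the universal property against all arrows with the same codomain). -/
def IsCartesianArrow (p : 𝒳 ⥤ 𝒮) {x y : 𝒳} (f : x ⟶ y) : Prop :=
  p.IsStronglyCartesian (p.map f) f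

/-- The functor `F` maps Cartesian arrows of `p` to Cartesian arrows of `p'`. -/
def PreservesCartesian (p : 𝒳 ⥤ 𝒮) (p' : 𝒳' ⥤ 𝒮') (F : 𝒳 ⥤ 𝒳') : Prop :=
  ∀ ⦃x y : 𝒳⦄ (f : x ⟶ y), IsCartesianArrow p f → IsCartesianArrow p' (F.map f)

/-- A cleavage of `p`: a choice of a Cartesian lift `map u : obj u ⟶ e` of every arrow
`u : b ⟶ p.obj e` of the base. -/
structure Cleavage (p : 𝒳 ⥤ 𝒮) where
  obj {b : 𝒮} {e : 𝒳} (u : b ⟶ p.obj e) : 𝒳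
  map {b : 𝒮} {e : 𝒳} (u : b ⟶ p.obj e) : obj u ⟶ e
  isStronglyCartesian {b : 𝒮} {e : 𝒳} (u : b ⟶ p.obj e) : p.IsStronglyCartesian u (map u)

/-- The arrows of the cleavage, i.e. the chosen lifts. -/
inductive Cleavage.Chosen {p : 𝒳 ⥤ 𝒮} (c : Cleavage p) : ∀ {x y : 𝒳}, (x ⟶ y) → Prop
  | lift {b : 𝒮} {e : 𝒳} (u : b ⟶ p.obj e) : Chosen c (c.map u)

/-- The functor `F` maps the arrows of the cleavage `c` to arrows of the cleavage `c'`. -/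
def PreservesCleavage {p : 𝒳 ⥤ 𝒮} {p' : 𝒳' ⥤ 𝒮'} (c : Cleavage p) (c' : Cleavage p')
    (F : 𝒳 ⥤ 𝒳') : Prop :=
  ∀ ⦃x y : 𝒳⦄ (f : x ⟶ y), c.Chosen f → c'.Chosen (F.map f)

end Fibrations

/-- The (strict) double functor `P` defines a double fibration: `P₀` and `P₁` are fibrations
admitting cleavages that are preserved by source and target, and the unit functor `y` and the
external composition `⊗` of the domain preserve Cartesian arrows (with respect to `P₀`, `P₁`
and `P₁ ×_{P₀} P₁`). -/
structure DefinesDoubleFibration {E B : Dbl.{v, u}} (P : PseudoDoubleFunctor E B) : Prop where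
  fibered_objFunctor : P.objFunctor.IsFibered
  fibered_arrFunctor : P.arrFunctor.IsFibered
  exists_cleavages : ∃ (c₀ : Cleavage P.objFunctor) (c₁ : Cleavage P.arrFunctor),
    PreservesCleavage c₁ c₀ E.srcFunctor ∧ PreservesCleavage c₁ c₀ E.tgtFunctor
  unit_cartesian : PreservesCartesian P.objFunctor P.arrFunctor E.unitFunctor
  comp_cartesian : PreservesCartesian P.pairFunctor P.arrFunctor E.compFunctor

end DblFib

/-!
The two directions rest on the same dictionary between Cartesian lifts of a 2-cell `β : b ⟶ e ≫ P`
and Cartesian lifts, with respect to `P₀` and `P₁`, of the components of `β`.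

*From an internal fibration to a double fibration.* The objects of the comma double category
`commaDbl P` are the arrows `b ⟶ P a` of `B`, its proarrows are the cells `m ⟶ P M`, and it carries
a universal transformation `commaDbl.universal P` whose components are all these arrows and cells.
A Cartesian lift `α` of it chooses a lift of every arrow into the image of `P₀` and of every cell
into the image of `P₁`; since the source and target of a cell component of `α` are its object
components, the two choices are compatible. That the lift of a cell is Cartesian
(`isCartesianArrow_appPro`) is tested on double functors out of the walking proarrow
(`walkingProarrow`), because proarrows and cells of `E` are double functors and transformations out
of it. The unit and composition axioms of `α` exhibit the images of chosen lifts under `y` and `⊗`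
as chosen lifts up to invertible cells. In particular a component at an object is Cartesian, being
the boundary of the Cartesian unit cell at that object. Finally all Cartesian arrows are preserved
by `y` and `⊗` since Cartesian lifts are unique up to isomorphism (`preservesCartesian_of_exists`).

*From a double fibration to an internal fibration.* The compatible cleavages lift all components of
a transformation `β : b ⟶ e ≫ P` with matching boundaries (`CartesianLifts`). The domains of the
lifts carry a double functor `CartesianLifts.functor`. As `y` and `⊗` preserve Cartesian arrows, the
units and composites of the chosen lifts are Cartesian, so they differ from the chosen lifts of
units and composites by invertible cells above the comparison cells of `b`; these are the
comparisons of the lifted double functor. Its axioms hold because they hold for `b` and for `e` and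
lifts through a Cartesian arrow are unique. A transformation with Cartesian components is a
Cartesian 2-cell (`existsUnique_lift_of_isCartesianArrow`), for the same reason.
-/

namespace DblFib

/-! ### Cartesian arrows -/

section Cartesian

universe v₁ v₂ v₃ v₄ u₁ u₂ u₃ u₄

variable {𝒳 : Type u₁} [Category.{v₁} 𝒳] {𝒮 : Type u₂} [Category.{v₂} 𝒮]
  {𝒳' : Type u₃} [Category.{v₃} 𝒳'] {𝒮' : Type u₄} [Category.{v₄} 𝒮']
  {p : 𝒳 ⥤ 𝒮} {p' : 𝒳' ⥤ 𝒮'}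

lemma isHomLift_iff_map_eq {a b : 𝒳} (g : p.obj a ⟶ p.obj b) (f : a ⟶ b) :
    p.IsHomLift g f ↔ p.map f = g :=
  ⟨fun _ => (IsHomLift.eq_of_isHomLift p g f).symm, fun h => h ▸ inferInstance⟩

lemma isHomLift_comp {R S T : 𝒮} {x y z : 𝒳} {f : R ⟶ S} {g : S ⟶ T} {φ : x ⟶ y} {ψ : y ⟶ z}
    (h : p.IsHomLift f φ) (h' : p.IsHomLift g ψ) : p.IsHomLift (f ≫ g) (φ ≫ ψ) :=
  inferInstance

lemma isHomLift_eqToHom (p : 𝒳 ⥤ 𝒮) {R S : 𝒮} {x y : 𝒳} (h : R = S) (h' : x = y)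
    (hx : p.obj x = R) : p.IsHomLift (eqToHom h) (eqToHom h') := by
  subst h h' hx
  exact IsHomLift.id rfl

lemma obj_eq_of_isHomLift {R S : 𝒮} {x y : 𝒳} {f : R ⟶ S} {φ : x ⟶ y} (_ : p.IsHomLift f φ) :
    p.obj x = R :=
  IsHomLift.domain_eq p f φ

lemma isCartesianArrow_iff {x y : 𝒳} (f : x ⟶ y) :
    IsCartesianArrow p f ↔ ∀ ⦃z : 𝒳⦄ (ξ : z ⟶ y) (γ : p.obj z ⟶ p.obj x),
      p.map ξ = γ ≫ p.map f → ∃! ζ : z ⟶ x, ζ ≫ f = ξ ∧ p.map ζ = γ := by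
  constructor
  · intro h z ξ γ e
    have : p.IsHomLift (γ ≫ p.map f) ξ := (isHomLift_iff_map_eq _ _).2 e
    simpa only [isHomLift_iff_map_eq, and_comm] using h.universal_property' γ ξ
  · intro h
    refine { universal_property' := fun γ ξ hξ => ?_ }
    simpa only [isHomLift_iff_map_eq, and_comm] using h ξ γ ((isHomLift_iff_map_eq _ _).1 hξ)

lemma IsCartesianArrow.isStronglyCartesian {x y : 𝒳} {f : x ⟶ y} (h : IsCartesianArrow p f)
    {R S : 𝒮} (w : R ⟶ S) [hw : p.IsHomLift w f] : p.IsStronglyCartesian w f := by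
  cases hw; exact h

lemma IsCartesianArrow.of_isStronglyCartesian {x y : 𝒳} {f : x ⟶ y} {R S : 𝒮} (w : R ⟶ S)
    [h : p.IsStronglyCartesian w f] : IsCartesianArrow p f := by
  obtain ⟨⟩ := h.toIsHomLift; exact h

lemma IsCartesianArrow.of_isIso {x y : 𝒳} (f : x ⟶ y) [IsIso f] : IsCartesianArrow p f :=
  inferInstanceAs (p.IsStronglyCartesian (p.map f) f)

lemma IsCartesianArrow.comp {x y z : 𝒳} {f : x ⟶ y} {g : y ⟶ z} (hf : IsCartesianArrow p f)
    (hg : IsCartesianArrow p g) : IsCartesianArrow p (f ≫ g) := by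
  have : p.IsStronglyCartesian (p.map f) f := hf
  have : p.IsStronglyCartesian (p.map g) g := hg
  exact .of_isStronglyCartesian (p.map f ≫ p.map g)

lemma IsCartesianArrow.existsUnique {x y : 𝒳} {f : x ⟶ y} (hf : IsCartesianArrow p f)
    {z : 𝒳} (ξ : z ⟶ y) (γ : p.obj z ⟶ p.obj x) (h : p.map ξ = γ ≫ p.map f) :
    ∃! ζ : z ⟶ x, ζ ≫ f = ξ ∧ p.map ζ = γ :=
  (isCartesianArrow_iff f).1 hf ξ γ h

lemma IsCartesianArrow.hom_ext {x y : 𝒳} {f : x ⟶ y} (hf : IsCartesianArrow p f) {z : 𝒳}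
    {ζ ζ' : z ⟶ x} (h : ζ ≫ f = ζ' ≫ f) (h' : p.map ζ = p.map ζ') : ζ = ζ' :=
  (hf.existsUnique (ζ' ≫ f) (p.map ζ') (p.map_comp _ _)).unique ⟨h, h'⟩ ⟨rfl, rfl⟩

/-- Two lifts of the same arrow of the base through a Cartesian arrow agree as soon as they agree
after composition with it. -/
lemma IsCartesianArrow.eq_of_isHomLift {x y : 𝒳} {f : x ⟶ y} (hf : IsCartesianArrow p f) {z : 𝒳}
    {ζ ζ' : z ⟶ x} {R S : 𝒮} (g : R ⟶ S) (h₁ : p.IsHomLift g ζ) (h₂ : p.IsHomLift g ζ')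
    (h : ζ ≫ f = ζ' ≫ f) : ζ = ζ' :=
  hf.hom_ext h ((IsHomLift.fac' p g ζ).trans (IsHomLift.fac' p g ζ').symm)

lemma IsCartesianArrow.exists_isHomLift {x y : 𝒳} {f : x ⟶ y} (hf : IsCartesianArrow p f) {z : 𝒳}
    (ξ : z ⟶ y) {R S T : 𝒮} (g : R ⟶ S) (w : S ⟶ T) (hw : p.IsHomLift w f)
    (h : p.IsHomLift (g ≫ w) ξ) : ∃ ζ : z ⟶ x, p.IsHomLift g ζ ∧ ζ ≫ f = ξ := by
  have := hf.isStronglyCartesian w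
  exact (this.universal_property p w f g _ rfl ξ).exists

/-- Since Cartesian lifts are unique up to isomorphism, Cartesian arrows are preserved as soon as
every arrow of the base has at least one Cartesian lift which is mapped to a Cartesian arrow. -/
lemma preservesCartesian_of_exists {F : 𝒳 ⥤ 𝒳'}
    (H : ∀ ⦃b : 𝒮⦄ ⦃y : 𝒳⦄ (w : b ⟶ p.obj y), ∃ (x : 𝒳) (g : x ⟶ y),
      p.IsHomLift w g ∧ IsCartesianArrow p g ∧ IsCartesianArrow p' (F.map g)) :
    PreservesCartesian p p' F := by
  intro z y f hf
  obtain ⟨x, g, hw, hg, hFg⟩ := H (p.map f)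
  have := hg.isStronglyCartesian (p.map f)
  have : p.IsStronglyCartesian (p.map f) f := hf
  have e : (Functor.IsCartesian.domainUniqueUpToIso p (p.map f) g f).hom ≫ g = f := by
    rw [Functor.IsCartesian.domainUniqueUpToIso_hom, Functor.IsCartesian.fac]
  rw [← e, F.map_comp]
  exact IsCartesianArrow.comp (.of_isIso _) hFg

end Cartesian

/-! ### Lifts along double functors -/

lemma ProArrow.of_injective {O : Type u} {Pro : O → O → Type u} {A B : O}
    {m n : Pro A B} (h : ProArrow.of m = ProArrow.of n) : m = n := by
  cases h; rfl

namespace Dbl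

variable (C : Dbl.{v, u})

@[simp] lemma left_eqToHom {m n : C.Arr} (h : m = n) :
    C.left (eqToHom h) = eqToHom (congrArg ProArrow.src h) := by
  subst h; simp

@[simp] lemma right_eqToHom {m n : C.Arr} (h : m = n) :
    C.right (eqToHom h) = eqToHom (congrArg ProArrow.tgt h) := by
  subst h; simp

lemma compMap_eqToHom {A B D : C.Obj} {m m' : C.Pro A B} {n n' : C.Pro B D}
    (h : m = m') (h' : n = n') :
    C.compMap (eqToHom (congrArg ProArrow.of h)) (eqToHom (congrArg ProArrow.of h'))
        (by simp) = eqToHom (by rw [h, h']) := by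
  subst h h'; simp

end Dbl

namespace PseudoDoubleFunctor

variable {C D : Dbl.{v, u}} (P : PseudoDoubleFunctor C D)

lemma isCartesianArrow_map_iff {A A' : C.Obj} (f : A ⟶ A') :
    IsCartesianArrow P.objFunctor f ↔ ∀ ⦃Z : C.Obj⦄ (ξ : Z ⟶ A') (γ : P.obj Z ⟶ P.obj A),
      P.map ξ = γ ≫ P.map f → ∃! ζ : Z ⟶ A, ζ ≫ f = ξ ∧ P.map ζ = γ :=
  isCartesianArrow_iff f

lemma isCartesianArrow_cell_iff {m n : C.Arr} (θ : m ⟶ n) :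
    IsCartesianArrow P.arrFunctor θ ↔ ∀ ⦃q : C.Arr⦄ (ξ : q ⟶ n)
      (γ : ProArrow.of (P.pro q.pro) ⟶ ProArrow.of (P.pro m.pro)),
      P.cell ξ = γ ≫ P.cell θ → ∃! ζ : q ⟶ m, ζ ≫ θ = ξ ∧ P.cell ζ = γ :=
  isCartesianArrow_iff θ

/-- A pair of Cartesian cells with a Cartesian common boundary is Cartesian for `P₁ ×_{P₀} P₁`. -/
lemma isCartesianArrow_pair {x y : C.Pair} (f : x ⟶ y)
    (h₁ : IsCartesianArrow P.arrFunctor (Dbl.Pair.Hom.fst f))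
    (h₂ : IsCartesianArrow P.arrFunctor (Dbl.Pair.Hom.snd f))
    (h : IsCartesianArrow P.objFunctor (C.right (Dbl.Pair.Hom.fst f))) :
    IsCartesianArrow P.pairFunctor f := by
  rw [isCartesianArrow_iff]
  intro z ξ γ e
  have e₁ : P.cell (Dbl.Pair.Hom.fst ξ) = Dbl.Pair.Hom.fst γ ≫ P.cell (Dbl.Pair.Hom.fst f) :=
    congrArg Dbl.Pair.Hom.fst e
  have e₂ : P.cell (Dbl.Pair.Hom.snd ξ) = Dbl.Pair.Hom.snd γ ≫ P.cell (Dbl.Pair.Hom.snd f) :=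
    congrArg Dbl.Pair.Hom.snd e
  obtain ⟨ζ₁, ⟨hζ₁, hζ₁'⟩, u₁⟩ := h₁.existsUnique (Dbl.Pair.Hom.fst ξ) (Dbl.Pair.Hom.fst γ) e₁
  obtain ⟨ζ₂, ⟨hζ₂, hζ₂'⟩, u₂⟩ := h₂.existsUnique (Dbl.Pair.Hom.snd ξ) (Dbl.Pair.Hom.snd γ) e₂
  have w : C.right ζ₁ = C.left ζ₂ := by
    refine h.hom_ext ?_ ?_
    · conv_rhs => rw [Dbl.Pair.Hom.w f]
      rw [← C.right_comp, ← C.left_comp, hζ₁, hζ₂, Dbl.Pair.Hom.w ξ]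
    · exact (P.right_cell _).symm.trans ((congrArg D.right hζ₁').trans
        ((Dbl.Pair.Hom.w γ).trans ((congrArg D.left hζ₂').symm.trans (P.left_cell _))))
  refine ⟨⟨ζ₁, ζ₂, w⟩, ⟨Dbl.Pair.Hom.ext hζ₁ hζ₂, Dbl.Pair.Hom.ext hζ₁' hζ₂'⟩, ?_⟩
  rintro ⟨ζ₁', ζ₂', w'⟩ ⟨h, h'⟩
  exact Dbl.Pair.Hom.ext
    (u₁ _ ⟨congrArg Dbl.Pair.Hom.fst h, congrArg Dbl.Pair.Hom.fst h'⟩)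
    (u₂ _ ⟨congrArg Dbl.Pair.Hom.snd h, congrArg Dbl.Pair.Hom.snd h'⟩)

lemma isHomLift_left {x y : D.Arr} {a b : C.Arr} {w : x ⟶ y} {θ : a ⟶ b}
    (h : P.arrFunctor.IsHomLift w θ) : P.objFunctor.IsHomLift (D.left w) (C.left θ) := by
  cases h
  have : D.left (P.arrFunctor.map θ) = P.objFunctor.map (C.left θ) := P.left_cell θ
  rw [this]
  exact .map _

lemma isHomLift_right {x y : D.Arr} {a b : C.Arr} {w : x ⟶ y} {θ : a ⟶ b}
    (h : P.arrFunctor.IsHomLift w θ) : P.objFunctor.IsHomLift (D.right w) (C.right θ) := by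
  cases h
  have : D.right (P.arrFunctor.map θ) = P.objFunctor.map (C.right θ) := P.right_cell θ
  rw [this]
  exact .map _

lemma isHomLift_cell {x y : D.Arr} {a b : C.Arr} {w : x ⟶ y} {θ : a ⟶ b}
    (h : ProArrow.of (P.pro a.pro) = x) (h' : ProArrow.of (P.pro b.pro) = y)
    (e : P.cell θ ≫ eqToHom h' = eqToHom h ≫ w) : P.arrFunctor.IsHomLift w θ :=
  IsHomLift.of_commsq _ _ _ h h' e

lemma map_eq_of_isHomLift {A B : C.Obj} {w : P.obj A ⟶ P.obj B} {f : A ⟶ B}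
    (h : P.objFunctor.IsHomLift w f) : P.map f = w :=
  (isHomLift_iff_map_eq (p := P.objFunctor) w f).1 h

lemma cell_eq_of_isHomLift {a b : C.Arr}
    {w : ProArrow.of (P.pro a.pro) ⟶ ProArrow.of (P.pro b.pro)} {θ : a ⟶ b}
    (h : P.arrFunctor.IsHomLift w θ) : P.cell θ = w :=
  (isHomLift_iff_map_eq (p := P.arrFunctor) w θ).1 h

lemma eq_of_isHomLift_cell {x y : D.Arr} {a b : C.Arr} {w : x ⟶ y} {θ : a ⟶ b}
    (_ : P.arrFunctor.IsHomLift w θ) (hx : x = ProArrow.of (P.pro a.pro))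
    (hy : ProArrow.of (P.pro b.pro) = y) : w = eqToHom hx ≫ P.cell θ ≫ eqToHom hy :=
  IsHomLift.fac P.arrFunctor w θ

variable {P} (hP : P.IsStrict)
include hP

lemma IsStrict.isHomLift_unitMap {X Y : D.Obj} {A B : C.Obj} {w : X ⟶ Y} {f : A ⟶ B}
    (h : P.objFunctor.IsHomLift w f) :
    P.arrFunctor.IsHomLift (D.unitMap w) (C.unitMap f) := by
  obtain rfl : P.obj A = X := IsHomLift.domain_eq P.objFunctor w f
  obtain rfl : P.obj B = Y := IsHomLift.codomain_eq P.objFunctor w f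
  obtain rfl := P.map_eq_of_isHomLift h
  refine P.isHomLift_cell (congrArg ProArrow.of (hP.pro_unit _)).symm
    (congrArg ProArrow.of (hP.pro_unit _)).symm ?_
  have := P.ι_naturality f
  rw [hP.ι_eq, hP.ι_eq] at this
  rw [← cancel_epi (eqToHom (congrArg ProArrow.of (hP.pro_unit A))), ← Category.assoc, ← this]
  simp

lemma IsStrict.isHomLift_compMap {X Y Z X' Y' Z' : D.Obj} {m : D.Pro X Y} {n : D.Pro Y Z}
    {m' : D.Pro X' Y'} {n' : D.Pro Y' Z'} {A B K A' B' K' : C.Obj} {M : C.Pro A B}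
    {N : C.Pro B K} {M' : C.Pro A' B'} {N' : C.Pro B' K'}
    {w : ProArrow.of m ⟶ ProArrow.of m'} {w' : ProArrow.of n ⟶ ProArrow.of n'}
    {θ : ProArrow.of M ⟶ ProArrow.of M'} {κ : ProArrow.of N ⟶ ProArrow.of N'}
    (h : P.arrFunctor.IsHomLift w θ) (h' : P.arrFunctor.IsHomLift w' κ)
    (e : D.right w = D.left w') (e' : C.right θ = C.left κ) :
    P.arrFunctor.IsHomLift (D.compMap w w' e) (C.compMap θ κ e') := by
  have d₁ : ProArrow.of (P.pro M) = ProArrow.of m := IsHomLift.domain_eq P.arrFunctor w θ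
  have d₂ : ProArrow.of (P.pro N) = ProArrow.of n := IsHomLift.domain_eq P.arrFunctor w' κ
  have d₃ : ProArrow.of (P.pro M') = ProArrow.of m' := IsHomLift.codomain_eq P.arrFunctor w θ
  have d₄ : ProArrow.of (P.pro N') = ProArrow.of n' := IsHomLift.codomain_eq P.arrFunctor w' κ
  cases d₁
  cases d₂
  cases d₃
  cases d₄
  obtain rfl := P.cell_eq_of_isHomLift h
  obtain rfl := P.cell_eq_of_isHomLift h'
  refine P.isHomLift_cell (congrArg ProArrow.of (hP.pro_comp _ _)).symm
    (congrArg ProArrow.of (hP.pro_comp _ _)).symm ?_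
  have := P.φ_naturality θ κ e'
  rw [hP.φ_eq, hP.φ_eq] at this
  rw [← cancel_epi (eqToHom (congrArg ProArrow.of (hP.pro_comp M N))), ← Category.assoc, ← this]
  simp

lemma IsStrict.isHomLift_assoc {X Y Z W : D.Obj} {m : D.Pro X Y} {n : D.Pro Y Z}
    {q : D.Pro Z W} {A B K L : C.Obj} {M : C.Pro A B} {N : C.Pro B K} {Q : C.Pro K L}
    (h : ProArrow.of (P.pro M) = ProArrow.of m) (h' : ProArrow.of (P.pro N) = ProArrow.of n)
    (h'' : ProArrow.of (P.pro Q) = ProArrow.of q) :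
    P.arrFunctor.IsHomLift (D.assoc m n q).hom (C.assoc M N Q).hom := by
  cases h
  cases h'
  cases h''
  have e := P.associativity M N Q
  have e₁ := D.compMap_congr (θ := (P.φ M N).hom) (κ := 𝟙 (ProArrow.of (P.pro Q)))
    (by simp) (hP.φ_eq M N) (eqToHom_refl _ rfl).symm
  have e₂ := D.compMap_congr (θ := 𝟙 (ProArrow.of (P.pro M))) (κ := (P.φ N Q).hom)
    (by simp) (eqToHom_refl _ rfl).symm (hP.φ_eq N Q)
  rw [e₁, e₂, D.compMap_eqToHom (hP.pro_comp M N) rfl, D.compMap_eqToHom rfl (hP.pro_comp N Q),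
    hP.φ_eq, hP.φ_eq, eqToHom_trans, eqToHom_trans_assoc] at e
  refine P.isHomLift_cell (by rw [hP.pro_comp, hP.pro_comp]) (by rw [hP.pro_comp, hP.pro_comp]) ?_
  rw [eqToHom_comp_iff] at e
  rw [e]
  simp

end PseudoDoubleFunctor

/-! ### Coherence for associators at units -/

/-- A monomorphism that is idempotent up to identifications of objects is an identification. -/
lemma eq_eqToHom_of_idempotent {𝒳 : Type*} [Category* 𝒳] {W X Y Z : 𝒳} (a : X ⟶ Y) [Mono a]
    (h₁ : W = X) (h₂ : Y = X) (h₃ : Y = Z)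
    (H : eqToHom h₁ ≫ a ≫ eqToHom h₂ ≫ a ≫ eqToHom h₃ = eqToHom h₁ ≫ a ≫ eqToHom h₃) :
    a = eqToHom h₂.symm := by
  subst h₁ h₂ h₃
  simpa [cancel_mono_id] using H

namespace Dbl

variable (C : Dbl.{v, u})

lemma assoc_congr {A B D K : C.Obj} {m m' : C.Pro A B} {n n' : C.Pro B D} {q q' : C.Pro D K}
    (hm : m = m') (hn : n = n') (hq : q = q') :
    (C.assoc m n q).hom = eqToHom (by rw [hm, hn, hq]) ≫ (C.assoc m' n' q').hom ≫
      eqToHom (by rw [hm, hn, hq]) := by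
  subst hm hn hq; simp

/-- An instance of Kelly's coherence lemma: the associator is an identity as soon as the first
proarrow is a unit. The pentagon at `y A`, `y A`, `m`, `n` reduces to an idempotency of this
associator: the associators with `y A` in the middle are identities, and tensoring with `y A` does
nothing. -/
lemma assoc_unit_left {A B D : C.Obj} (m : C.Pro A B) (n : C.Pro B D) :
    (C.assoc (C.unitPro A) m n).hom = eqToHom (by rw [C.unit_comp, C.unit_comp]) := by
  have pent := C.pentagon (C.unitPro A) (C.unitPro A) m n
  have e₁ := C.compMap_congr (κ := 𝟙 (ProArrow.of n)) (by simp) (C.triangle (C.unitPro A) m)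
    (eqToHom_refl _ rfl).symm
  have e₂ := C.unit_compMap (C.assoc (C.unitPro A) m n).hom
  have e₃ := C.compMap_congr (κ := (C.assoc (C.unitPro A) m n).hom)
    (C.right_unitMap _)
    ((congrArg (fun f => C.unitMap f) (C.left_assoc (C.unitPro A) m n)).trans (C.unitMap_id A)) rfl
  rw [e₁, C.compMap_eqToHom ((congrArg (fun k => C.comp k m) (C.comp_unit _)).trans
      (congrArg (C.comp _) (C.unit_comp m)).symm) rfl, C.triangle,
    C.assoc_congr rfl (C.unit_comp m) rfl,
    C.assoc_congr (C.unit_comp (C.unitPro A)) rfl rfl] at pent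
  rw [e₃, comp_eqToHom_iff] at e₂
  rw [e₂] at pent
  simp only [Category.assoc, eqToHom_trans_assoc, eqToHom_trans] at pent
  exact eq_eqToHom_of_idempotent _ _ _ _ pent

end Dbl

/-! ### The walking proarrow -/

/-- The two objects of the walking proarrow. -/
inductive WalkingObj : Type u
  | zero
  | one

/-- The proarrows of the walking proarrow: one proarrow `zero ⇸ one` and the units. -/
inductive WalkingPro : WalkingObj.{u} → WalkingObj.{u} → Type u
  | unit (A : WalkingObj) : WalkingPro A A
  | gen : WalkingPro .zero .one

/-- Composition in the walking proarrow. -/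
def WalkingPro.comp : ∀ {A B C : WalkingObj.{u}}, WalkingPro A B → WalkingPro B C → WalkingPro A C
  | _, _, _, .unit _, n => n
  | _, _, _, .gen, .unit _ => .gen

/-- The discrete category on a type, with homs in an arbitrary universe. -/
abbrev discreteCategory (α : Type u) : Category.{v} α where
  Hom a b := ULift (PLift (a = b))
  id _ := ⟨⟨rfl⟩⟩
  comp f g := ⟨⟨f.down.down.trans g.down.down⟩⟩

/-- The arrow of a discrete category given by an equality. -/
def discreteHom {α : Type u} {a b : α} (h : a = b) :
    @Quiver.Hom α (discreteCategory.{v} α).toQuiver a b := ⟨⟨h⟩⟩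

lemma eq_of_discreteHom {α : Type u} {a b : α}
    (f : @Quiver.Hom α (discreteCategory.{v} α).toQuiver a b) : a = b := f.down.down

instance : Category.{v} WalkingObj.{u} := discreteCategory _

instance : Category.{v} (ProArrow WalkingPro.{u}) := discreteCategory _

/-- The walking proarrow, i.e. the free double category on a proarrow. All its arrows and cells
are identities. -/
abbrev walkingProarrow : Dbl.{v, u} where
  Obj := WalkingObj
  Pro := WalkingPro
  left θ := discreteHom (congrArg ProArrow.src (eq_of_discreteHom θ))
  right θ := discreteHom (congrArg ProArrow.tgt (eq_of_discreteHom θ))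
  left_id _ := rfl
  right_id _ := rfl
  left_comp _ _ := rfl
  right_comp _ _ := rfl
  unitPro A := .unit A
  unitMap f := discreteHom
    (congrArg (fun A => ProArrow.of (WalkingPro.unit A)) (eq_of_discreteHom f))
  left_unitMap _ := rfl
  right_unitMap _ := rfl
  unitMap_id _ := rfl
  unitMap_comp _ _ := rfl
  comp := WalkingPro.comp
  compMap θ κ _ := discreteHom (by
    cases eq_of_discreteHom θ
    cases eq_of_discreteHom κ
    rfl)
  left_compMap _ _ _ := rfl
  right_compMap _ _ _ := rfl
  compMap_id _ _ := rfl
  compMap_comp _ _ _ _ _ _ := rfl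
  assoc m n p :=
    have h : (m.comp n).comp p = m.comp (n.comp p) := by cases m <;> cases n <;> cases p <;> rfl
    ⟨discreteHom (congrArg _ h), discreteHom (congrArg _ h.symm), rfl, rfl⟩
  left_assoc _ _ _ := rfl
  right_assoc _ _ _ := rfl
  assoc_naturality _ _ _ _ _ := rfl
  pentagon _ _ _ _ := rfl
  unit_comp _ := rfl
  comp_unit m := by cases m <;> rfl
  unit_compMap _ := rfl
  compMap_unit _ := rfl
  triangle _ _ := rfl

namespace walkingProarrow

/-- The generating proarrow. -/
abbrev gen : walkingProarrow.{v, u}.Pro WalkingObj.zero WalkingObj.one := WalkingPro.gen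

variable {D : Dbl.{v, u}}

/-- The object part of `pick`. -/
def pickObj (A B : D.Obj) : WalkingObj.{u} → D.Obj
  | .zero => A
  | .one => B

/-- The proarrow part of `pick`. -/
def pickPro {A B : D.Obj} (m : D.Pro A B) : ∀ {i j : WalkingObj.{u}}, WalkingPro i j →
    D.Pro (pickObj A B i) (pickObj A B j)
  | _, _, .unit _ => D.unitPro _
  | _, _, .gen => m

lemma pickPro_comp {A B : D.Obj} (m : D.Pro A B) {i j k : WalkingObj.{u}} (x : WalkingPro i j)
    (y : WalkingPro j k) : D.comp (pickPro m x) (pickPro m y) = pickPro m (x.comp y) := by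
  cases x
  · exact D.unit_comp _
  · cases y
    exact D.comp_unit _

lemma pickPro_assoc {A B : D.Obj} (m : D.Pro A B) {i j k l : WalkingObj.{u}} (x : WalkingPro i j)
    (y : WalkingPro j k) (z : WalkingPro k l) :
    (D.assoc (pickPro m x) (pickPro m y) (pickPro m z)).hom = eqToHom (by
      simp only [pickPro_comp]; cases x <;> cases y <;> cases z <;> rfl) := by
  cases x
  · exact D.assoc_unit_left _ _
  · cases y
    exact D.triangle _ _

/-- The double functor on the walking proarrow classifying a proarrow `m`. It preserves units and
composites on the nose because units are strict in `D`. -/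
def pick {A B : D.Obj} (m : D.Pro A B) : PseudoDoubleFunctor walkingProarrow.{v, u} D where
  obj := pickObj A B
  map f := eqToHom (congrArg (pickObj A B) (eq_of_discreteHom f))
  map_id _ := rfl
  map_comp _ _ := by simp
  pro x := pickPro m x
  cell θ := eqToHom (congrArg (fun x => ProArrow.of (pickPro m x.pro)) (eq_of_discreteHom θ))
  cell_id _ := rfl
  cell_comp _ _ := by simp
  left_cell _ := by simp
  right_cell _ := by simp
  φ x y := eqToIso (congrArg ProArrow.of (pickPro_comp m x y))
  left_φ _ _ := by simp
  right_φ _ _ := by simp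
  φ_naturality θ κ h := by
    cases eq_of_discreteHom θ
    cases eq_of_discreteHom κ
    simp
  ι _ := Iso.refl _
  left_ι _ := D.left_id _
  right_ι _ := D.right_id _
  ι_naturality f := by
    cases eq_of_discreteHom f
    simp
    rfl
  associativity x y z := by
    have e₁ := D.compMap_congr (θ := eqToHom (congrArg ProArrow.of (pickPro_comp m x y)))
      (κ := 𝟙 (ProArrow.of (pickPro m z))) (by simp) rfl (eqToHom_refl _ rfl).symm
    have e₂ := D.compMap_congr (θ := 𝟙 (ProArrow.of (pickPro m x)))
      (κ := eqToHom (congrArg ProArrow.of (pickPro_comp m y z)))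
      (by simp) (eqToHom_refl _ rfl).symm rfl
    simp only [eqToIso.hom]
    rw [e₁, e₂, D.compMap_eqToHom (pickPro_comp m x y) rfl,
      D.compMap_eqToHom rfl (pickPro_comp m y z), pickPro_assoc]
    simp
  left_unitality x := by
    refine (congrArg (· ≫ _) (D.compMap_id _ _)).trans ((Category.id_comp _).trans ?_)
    rw [eqToIso.hom]
    exact eqToHom_trans (congrArg ProArrow.of (pickPro_comp m _ _))
      (congrArg (fun y => ProArrow.of (pickPro m y)) (walkingProarrow.unit_comp x))
  right_unitality x := by
    refine (congrArg (· ≫ _) (D.compMap_id _ _)).trans ((Category.id_comp _).trans ?_)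
    rw [eqToIso.hom]
    exact eqToHom_trans (congrArg ProArrow.of (pickPro_comp m _ _))
      (congrArg (fun y => ProArrow.of (pickPro m y)) (walkingProarrow.comp_unit x))

end walkingProarrow

namespace PseudoDoubleFunctor

variable {C D : Dbl.{v, u}}

@[simp] lemma left_ι_inv (F : PseudoDoubleFunctor C D) (A : C.Obj) : D.left (F.ι A).inv = 𝟙 _ := by
  have h := congrArg D.left (F.ι A).hom_inv_id
  rw [D.left_comp, F.left_ι, D.left_id] at h
  exact (Category.id_comp _).symm.trans h

@[simp] lemma right_ι_inv (F : PseudoDoubleFunctor C D) (A : C.Obj) :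
    D.right (F.ι A).inv = 𝟙 _ := by
  have h := congrArg D.right (F.ι A).hom_inv_id
  rw [D.right_comp, F.right_ι, D.right_id] at h
  exact (Category.id_comp _).symm.trans h

variable (F G : PseudoDoubleFunctor C D)

/-- The compatibility of a transformation with `φ` follows from the compatibility with `ι` if the
first proarrow is a unit. -/
lemma compMap_unit_left {A B : C.Obj} (n : C.Pro A B)
    (θ : ProArrow.of (F.pro n) ⟶ ProArrow.of (G.pro n)) {f : F.obj A ⟶ G.obj A}
    (hf : D.left θ = f)
    {κ : ProArrow.of (F.pro (C.comp (C.unitPro A) n)) ⟶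
      ProArrow.of (G.pro (C.comp (C.unitPro A) n))}
    (hκ : F.cell (eqToHom (congrArg ProArrow.of (C.unit_comp n))) ≫ θ =
      κ ≫ G.cell (eqToHom (congrArg ProArrow.of (C.unit_comp n)))) :
    D.compMap ((F.ι A).inv ≫ D.unitMap f ≫ (G.ι A).hom) θ (by simp [hf]) ≫
        (G.φ (C.unitPro A) n).hom = (F.φ (C.unitPro A) n).hom ≫ κ := by
  subst hf
  have : Mono (G.cell (eqToHom (congrArg ProArrow.of (C.unit_comp n)))) := by
    rw [G.cell_eqToHom (C.unit_comp n)]; infer_instance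
  rw [← cancel_mono (G.cell (eqToHom (congrArg ProArrow.of (C.unit_comp n)))), Category.assoc,
    Category.assoc, ← hκ]
  have hF := F.left_unitality n
  have hG := G.left_unitality n
  have c₁ := D.compMap_comp (F.ι A).inv (𝟙 (ProArrow.of (F.pro n))) (F.ι A).hom (𝟙 _)
    (by simp) (by simp)
  have c₂ := D.compMap_comp (F.ι A).inv (𝟙 (ProArrow.of (F.pro n)))
    (D.unitMap (D.left θ) ≫ (G.ι A).hom) θ (by simp) (by simp)
  have c₃ := D.compMap_comp (D.unitMap (D.left θ)) θ (G.ι A).hom (𝟙 (ProArrow.of (G.pro n)))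
    (by simp) (by simp)
  have c₄ := D.compMap_congr (θ := (F.ι A).inv ≫ (F.ι A).hom)
    (κ := 𝟙 (ProArrow.of (F.pro n)) ≫ 𝟙 (ProArrow.of (F.pro n))) (by simp)
    (F.ι A).inv_hom_id (Category.id_comp _)
  rw [D.compMap_id, c₁] at c₄
  simp only [Category.id_comp, Category.comp_id] at c₂ c₃
  -- The left unitality of `F`, with the comparison `ι` moved to the other side.
  have key := congrArg (D.compMap (F.ι A).inv (𝟙 (ProArrow.of (F.pro n))) (by simp) ≫ ·) hF
  simp only [← Category.assoc, c₄] at key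
  simp only [Category.id_comp] at key
  rw [c₂, c₃, reassoc_of% key, Category.assoc, Category.assoc, hG, D.unit_compMap]

/-- The compatibility of a transformation with `φ` follows from the compatibility with `ι` if the
second proarrow is a unit. -/
lemma compMap_unit_right {A B : C.Obj} (n : C.Pro A B)
    (θ : ProArrow.of (F.pro n) ⟶ ProArrow.of (G.pro n)) {f : F.obj B ⟶ G.obj B}
    (hf : D.right θ = f)
    {κ : ProArrow.of (F.pro (C.comp n (C.unitPro B))) ⟶
      ProArrow.of (G.pro (C.comp n (C.unitPro B)))}
    (hκ : F.cell (eqToHom (congrArg ProArrow.of (C.comp_unit n))) ≫ θ =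
      κ ≫ G.cell (eqToHom (congrArg ProArrow.of (C.comp_unit n)))) :
    D.compMap θ ((F.ι B).inv ≫ D.unitMap f ≫ (G.ι B).hom) (by simp [hf]) ≫
        (G.φ n (C.unitPro B)).hom = (F.φ n (C.unitPro B)).hom ≫ κ := by
  subst hf
  have : Mono (G.cell (eqToHom (congrArg ProArrow.of (C.comp_unit n)))) := by
    rw [G.cell_eqToHom (C.comp_unit n)]; infer_instance
  rw [← cancel_mono (G.cell (eqToHom (congrArg ProArrow.of (C.comp_unit n)))), Category.assoc,
    Category.assoc, ← hκ]
  have hF := F.right_unitality n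
  have hG := G.right_unitality n
  have c₁ := D.compMap_comp (𝟙 (ProArrow.of (F.pro n))) (F.ι B).inv (𝟙 _) (F.ι B).hom
    (by simp) (by simp)
  have c₂ := D.compMap_comp (𝟙 (ProArrow.of (F.pro n))) (F.ι B).inv
    θ (D.unitMap (D.right θ) ≫ (G.ι B).hom) (by simp) (by simp)
  have c₃ := D.compMap_comp θ (D.unitMap (D.right θ)) (𝟙 (ProArrow.of (G.pro n))) (G.ι B).hom
    (by simp) (by simp)
  have c₄ := D.compMap_congr (θ := 𝟙 (ProArrow.of (F.pro n)) ≫ 𝟙 (ProArrow.of (F.pro n)))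
    (κ := (F.ι B).inv ≫ (F.ι B).hom) (by simp) (Category.id_comp _) (F.ι B).inv_hom_id
  rw [D.compMap_id, c₁] at c₄
  simp only [Category.id_comp, Category.comp_id] at c₂ c₃
  -- The right unitality of `F`, with the comparison `ι` moved to the other side.
  have key := congrArg (D.compMap (𝟙 (ProArrow.of (F.pro n))) (F.ι B).inv (by simp) ≫ ·) hF
  simp only [← Category.assoc, c₄] at key
  simp only [Category.id_comp] at key
  rw [c₂, c₃, reassoc_of% key, Category.assoc, Category.assoc, hG, D.compMap_unit]

end PseudoDoubleFunctor

namespace walkingProarrow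

variable {D : Dbl.{v, u}} {F G : PseudoDoubleFunctor walkingProarrow.{v, u} D}

/-- A transformation out of the walking proarrow is determined by its component at the generating
proarrow. -/
lemma hom_ext {α β : F ⟶ G}
    (h : Transformation.appPro α gen = Transformation.appPro β gen) : α = β := by
  have app : ∀ A, Transformation.app α A = Transformation.app β A := by
    rintro (_ | _)
    · exact (Transformation.left_appPro α gen).symm.trans
        ((congrArg D.left h).trans (Transformation.left_appPro β gen))
    · exact (Transformation.right_appPro α gen).symm.trans
        ((congrArg D.right h).trans (Transformation.right_appPro β gen))
  refine Transformation.hom_ext app ?_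
  rintro A _ (_ | _)
  · have e : (F.ι A).hom ≫ Transformation.appPro α (walkingProarrow.unitPro A) =
        (F.ι A).hom ≫ Transformation.appPro β (walkingProarrow.unitPro A) := by
      rw [← Transformation.unit, ← Transformation.unit, app]
    exact (cancel_epi _).1 e
  · exact h

/-- The components of `ofCell` at objects. -/
def ofCellApp (θ : ProArrow.of (F.pro gen) ⟶ ProArrow.of (G.pro gen)) :
    ∀ A, F.obj A ⟶ G.obj A
  | WalkingObj.zero => D.left θ
  | WalkingObj.one => D.right θ

/-- The components of `ofCell` at proarrows; those at units are forced by the compatibility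
with `ι`. -/
def ofCellAppPro (θ : ProArrow.of (F.pro gen) ⟶ ProArrow.of (G.pro gen)) :
    ∀ {A B : WalkingObj.{u}} (m : WalkingPro A B), ProArrow.of (F.pro m) ⟶ ProArrow.of (G.pro m)
  | _, _, WalkingPro.unit A => (F.ι A).inv ≫ D.unitMap (ofCellApp θ A) ≫ (G.ι A).hom
  | _, _, WalkingPro.gen => θ

lemma left_ofCellAppPro (θ : ProArrow.of (F.pro gen) ⟶ ProArrow.of (G.pro gen))
    {A B : WalkingObj.{u}} (m : WalkingPro A B) :
    D.left (ofCellAppPro θ m) = ofCellApp θ A := by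
  cases m
  · simp [ofCellAppPro]
  · rfl

lemma right_ofCellAppPro (θ : ProArrow.of (F.pro gen) ⟶ ProArrow.of (G.pro gen))
    {A B : WalkingObj.{u}} (m : WalkingPro A B) :
    D.right (ofCellAppPro θ m) = ofCellApp θ B := by
  cases m
  · simp [ofCellAppPro]
  · rfl

/-- The transformation out of the walking proarrow with a given component at the generating
proarrow. -/
def ofCell (θ : ProArrow.of (F.pro gen) ⟶ ProArrow.of (G.pro gen)) : F ⟶ G where
  app := ofCellApp θ
  appPro m := ofCellAppPro θ m
  left_appPro m := left_ofCellAppPro θ m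
  right_appPro m := right_ofCellAppPro θ m
  naturality {A B} f := by
    cases eq_of_discreteHom f
    have e₁ : F.map f = 𝟙 _ := F.map_id A
    have e₂ : G.map f = 𝟙 _ := G.map_id A
    rw [e₁, e₂, Category.id_comp, Category.comp_id]
  naturality_cell {m n} κ := by
    cases eq_of_discreteHom κ
    have e₁ : F.cell κ = 𝟙 _ := F.cell_id m
    have e₂ : G.cell κ = 𝟙 _ := G.cell_id m
    rw [e₁, e₂]
    exact (Category.id_comp _).trans (Category.comp_id _).symm
  unit A := by
    change _ = _ ≫ (F.ι A).inv ≫ D.unitMap (ofCellApp θ A) ≫ (G.ι A).hom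
    simp
  comp {A B K} m n := by
    obtain _ | _ := m
    · exact F.compMap_unit_left G n _ (left_ofCellAppPro θ n)
        (((congrArg (· ≫ _) (F.cell_id _)).trans (Category.id_comp _)).trans
          ((congrArg (ofCellAppPro θ n ≫ ·) (G.cell_id _)).trans (Category.comp_id _)).symm)
    · obtain _ | _ := n
      exact F.compMap_unit_right G gen θ rfl
        (((congrArg (· ≫ _) (F.cell_id _)).trans (Category.id_comp _)).trans
          ((congrArg (θ ≫ ·) (G.cell_id _)).trans (Category.comp_id _)).symm)

end walkingProarrow

/-! ### The comma double category -/

section Comma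

variable {E B : Dbl.{v, max v u}} (P : PseudoDoubleFunctor E B)

/-- Objects of the comma double category `B ↓ P`. -/
structure CommaObj : Type (max v u) where
  base : B.Obj
  total : E.Obj
  arr : base ⟶ P.obj total

variable {P}

/-- Arrows of the comma double category `B ↓ P`: commutative squares. -/
@[ext] structure CommaHom (x y : CommaObj P) : Type v where
  base : x.base ⟶ y.base
  total : x.total ⟶ y.total
  w : base ≫ y.arr = x.arr ≫ P.map total

/-- Proarrows of the comma double category `B ↓ P`: cells of `B` whose codomain is in the image
of `P`, with the given boundary. -/
structure CommaPro (x y : CommaObj P) : Type (max v u) where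
  base : B.Pro x.base y.base
  total : E.Pro x.total y.total
  cell : ProArrow.of base ⟶ ProArrow.of (P.pro total)
  left_cell : B.left cell = x.arr
  right_cell : B.right cell = y.arr

attribute [simp] CommaPro.left_cell CommaPro.right_cell

lemma CommaPro.ext_of_eqToHom {x y : CommaObj P} {m n : CommaPro x y} (h : m.base = n.base)
    (h' : m.total = n.total)
    (e : m.cell ≫ eqToHom (congrArg (fun k => ProArrow.of (P.pro k)) h') =
      eqToHom (congrArg ProArrow.of h) ≫ n.cell) : m = n := by
  obtain ⟨a, b, c, _, _⟩ := m
  obtain ⟨a', b', c', _, _⟩ := n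
  dsimp only at h h'
  subst h h'
  obtain rfl : c = c' := by simpa using e
  rfl

/-- Cells of the comma double category `B ↓ P`: commutative squares of cells. -/
@[ext] structure CommaCell (m n : ProArrow (CommaPro (P := P))) : Type v where
  base : ProArrow.of m.pro.base ⟶ ProArrow.of n.pro.base
  total : ProArrow.of m.pro.total ⟶ ProArrow.of n.pro.total
  w : base ≫ n.pro.cell = m.pro.cell ≫ P.cell total

instance : Category.{v} (CommaObj P) where
  Hom := CommaHom
  id x := CommaHom.mk (𝟙 _) (𝟙 _) (by simp)
  comp f g := CommaHom.mk (f.base ≫ g.base) (f.total ≫ g.total) (by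
    rw [Category.assoc, g.w, reassoc_of% f.w, P.map_comp])

instance : Category.{v} (ProArrow (CommaPro (P := P))) where
  Hom := CommaCell
  id x := CommaCell.mk (𝟙 _) (𝟙 _) (by simp)
  comp f g := CommaCell.mk (f.base ≫ g.base) (f.total ≫ g.total) (by
    rw [Category.assoc, g.w, reassoc_of% f.w, P.cell_comp])

section

variable {x y z : CommaObj P} {m n q : ProArrow (CommaPro (P := P))}

@[ext] lemma CommaHom.hom_ext {f g : x ⟶ y} (h : CommaHom.base f = CommaHom.base g)
    (h' : CommaHom.total f = CommaHom.total g) : f = g :=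
  CommaHom.ext h h'

@[simp] lemma CommaHom.base_id : CommaHom.base (𝟙 x) = 𝟙 _ := rfl

@[simp] lemma CommaHom.total_id : CommaHom.total (𝟙 x) = 𝟙 _ := rfl

@[simp] lemma CommaHom.base_comp (f : x ⟶ y) (g : y ⟶ z) :
    CommaHom.base (f ≫ g) = CommaHom.base f ≫ CommaHom.base g := rfl

@[simp] lemma CommaHom.total_comp (f : x ⟶ y) (g : y ⟶ z) :
    CommaHom.total (f ≫ g) = CommaHom.total f ≫ CommaHom.total g := rfl

@[ext] lemma CommaCell.hom_ext {θ κ : m ⟶ n} (h : CommaCell.base θ = CommaCell.base κ)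
    (h' : CommaCell.total θ = CommaCell.total κ) : θ = κ :=
  CommaCell.ext h h'

@[simp] lemma CommaCell.base_id : CommaCell.base (𝟙 m) = 𝟙 _ := rfl

@[simp] lemma CommaCell.total_id : CommaCell.total (𝟙 m) = 𝟙 _ := rfl

@[simp] lemma CommaCell.base_comp (θ : m ⟶ n) (κ : n ⟶ q) :
    CommaCell.base (θ ≫ κ) = CommaCell.base θ ≫ CommaCell.base κ := rfl

@[simp] lemma CommaCell.total_comp (θ : m ⟶ n) (κ : n ⟶ q) :
    CommaCell.total (θ ≫ κ) = CommaCell.total θ ≫ CommaCell.total κ := rfl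

end

lemma CommaCell.eqToHom_base {m n : ProArrow (CommaPro (P := P))} (h : m = n) :
    CommaCell.base (eqToHom h) =
      eqToHom (congrArg (fun k : ProArrow (CommaPro (P := P)) => ProArrow.of k.pro.base) h) := by
  subst h; rfl

lemma CommaCell.eqToHom_total {m n : ProArrow (CommaPro (P := P))} (h : m = n) :
    CommaCell.total (eqToHom h) =
      eqToHom (congrArg (fun k : ProArrow (CommaPro (P := P)) => ProArrow.of k.pro.total) h) := by
  subst h; rfl

/-- External composition in the comma double category. -/
abbrev CommaPro.comp {x y z : CommaObj P} (m : CommaPro x y) (n : CommaPro y z) :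
    CommaPro x z where
  base := B.comp m.base n.base
  total := E.comp m.total n.total
  cell := B.compMap m.cell n.cell (by simp) ≫ (P.φ _ _).hom
  left_cell := by simp
  right_cell := by simp

/-- Units in the comma double category. -/
abbrev CommaPro.unit (x : CommaObj P) : CommaPro x x where
  base := B.unitPro x.base
  total := E.unitPro x.total
  cell := B.unitMap x.arr ≫ (P.ι _).hom
  left_cell := by simp
  right_cell := by simp

lemma CommaCell.assoc_w {x y z w : CommaObj P} (m : CommaPro x y) (n : CommaPro y z)
    (q : CommaPro z w) :
    (B.assoc m.base n.base q.base).hom ≫ (m.comp (n.comp q)).cell =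
      ((m.comp n).comp q).cell ≫ P.cell (E.assoc m.total n.total q.total).hom := by
  have c₁ := B.compMap_comp (B.compMap m.cell n.cell (by simp)) q.cell (P.φ m.total n.total).hom
    (𝟙 _) (by simp) (by simp)
  have c₂ := B.compMap_comp m.cell (B.compMap n.cell q.cell (by simp))
    (𝟙 _) (P.φ n.total q.total).hom (by simp) (by simp)
  have a := P.associativity m.total n.total q.total
  have b := B.assoc_naturality m.cell n.cell q.cell (by simp) (by simp)
  simp only [Category.comp_id] at c₁ c₂
  change _ ≫ B.compMap m.cell (B.compMap n.cell q.cell _ ≫ (P.φ n.total q.total).hom) _ ≫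
      (P.φ m.total (E.comp n.total q.total)).hom =
    (B.compMap (B.compMap m.cell n.cell _ ≫ (P.φ m.total n.total).hom) q.cell _ ≫
      (P.φ (E.comp m.total n.total) q.total).hom) ≫ _
  rw [c₁, c₂, Category.assoc, Category.assoc, Category.assoc, a, reassoc_of% b]

lemma CommaCell.assoc_inv_w {x y z w : CommaObj P} (m : CommaPro x y) (n : CommaPro y z)
    (q : CommaPro z w) :
    (B.assoc m.base n.base q.base).inv ≫ ((m.comp n).comp q).cell =
      (m.comp (n.comp q)).cell ≫ P.cell (E.assoc m.total n.total q.total).inv := by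
  rw [Iso.inv_comp_eq, ← Category.assoc, assoc_w, Category.assoc, ← P.cell_comp,
    Iso.hom_inv_id, P.cell_id, Category.comp_id]

lemma CommaCell.comp_w {x y z x' y' z' : CommaObj P} {m : CommaPro x y} {n : CommaPro y z}
    {m' : CommaPro x' y'} {n' : CommaPro y' z'} (θ : ProArrow.of m ⟶ ProArrow.of m')
    (κ : ProArrow.of n ⟶ ProArrow.of n')
    (h : B.right (CommaCell.base θ) = B.left (CommaCell.base κ))
    (h' : E.right (CommaCell.total θ) = E.left (CommaCell.total κ)) :
    B.compMap (CommaCell.base θ) (CommaCell.base κ) h ≫ (m'.comp n').cell =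
      (m.comp n).cell ≫ P.cell (E.compMap (CommaCell.total θ) (CommaCell.total κ) h') := by
  have c₁ := B.compMap_comp (CommaCell.base θ) (CommaCell.base κ) m'.cell n'.cell h (by simp)
  have c₂ := B.compMap_comp m.cell n.cell (P.cell (CommaCell.total θ)) (P.cell (CommaCell.total κ))
    (by simp) (by simp [h'])
  have c₃ := B.compMap_congr (by simp [h]) (CommaCell.w θ) (CommaCell.w κ)
  change _ ≫ B.compMap m'.cell n'.cell _ ≫ (P.φ m'.total n'.total).hom =
    (B.compMap m.cell n.cell _ ≫ (P.φ m.total n.total).hom) ≫ _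
  have e := P.φ_naturality (CommaCell.total θ) (CommaCell.total κ) h'
  rw [Category.assoc, ← e, ← Category.assoc, ← c₁, c₃, ← Category.assoc, ← c₂]

lemma CommaPro.unit_comp {x y : CommaObj P} (m : CommaPro x y) :
    (CommaPro.unit x).comp m = m := by
  refine CommaPro.ext_of_eqToHom (B.unit_comp _) (E.unit_comp _) ?_
  have c := B.compMap_comp (B.unitMap x.arr) m.cell (P.ι x.total).hom (𝟙 _) (by simp) (by simp)
  have h := P.left_unitality m.total
  have k := B.unit_compMap m.cell
  have l := B.compMap_congr (κ := m.cell) (by simp)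
    (congrArg (fun f => B.unitMap f) m.left_cell) rfl
  simp only [Category.comp_id] at c
  rw [P.cell_eqToHom (E.unit_comp m.total)] at h
  rw [l] at k
  change (B.compMap (B.unitMap x.arr ≫ (P.ι x.total).hom) m.cell _ ≫
    (P.φ (E.unitPro x.total) m.total).hom) ≫ _ = _
  rw [c, Category.assoc, Category.assoc, h, k]

lemma CommaPro.comp_unit {x y : CommaObj P} (m : CommaPro x y) :
    m.comp (CommaPro.unit y) = m := by
  refine CommaPro.ext_of_eqToHom (B.comp_unit _) (E.comp_unit _) ?_
  have c := B.compMap_comp m.cell (B.unitMap y.arr) (𝟙 _) (P.ι y.total).hom (by simp) (by simp)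
  have h := P.right_unitality m.total
  have k := B.compMap_unit m.cell
  have l := B.compMap_congr (θ := m.cell) (by simp) rfl
    (congrArg (fun f => B.unitMap f) m.right_cell)
  simp only [Category.comp_id] at c
  rw [P.cell_eqToHom (E.comp_unit m.total)] at h
  rw [l] at k
  change (B.compMap m.cell (B.unitMap y.arr ≫ (P.ι y.total).hom) _ ≫
    (P.φ m.total (E.unitPro y.total)).hom) ≫ _ = _
  rw [c, Category.assoc, Category.assoc, h, k]

variable (P)

/-- The comma double category `B ↓ P` of a double functor `P : E ⟶ B`. Its objects involve an object
of `E` and an arrow of `B`, hence live in the maximum of the two universes. -/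
abbrev commaDbl : Dbl.{v, max v u} where
  Obj := CommaObj P
  Pro := CommaPro
  left θ := CommaHom.mk (B.left (CommaCell.base θ)) (E.left (CommaCell.total θ)) (by
    have := congrArg B.left (CommaCell.w θ)
    simpa using this)
  right θ := CommaHom.mk (B.right (CommaCell.base θ)) (E.right (CommaCell.total θ)) (by
    have := congrArg B.right (CommaCell.w θ)
    simpa using this)
  left_id m := by ext <;> simp
  right_id m := by ext <;> simp
  left_comp _ _ := by ext <;> simp
  right_comp _ _ := by ext <;> simp
  unitPro := CommaPro.unit
  unitMap f := CommaCell.mk (B.unitMap (CommaHom.base f)) (E.unitMap (CommaHom.total f)) (by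
    have := P.ι_naturality (CommaHom.total f)
    rw [Category.assoc, ← this, ← Category.assoc, ← B.unitMap_comp, CommaHom.w f, B.unitMap_comp,
      Category.assoc])
  left_unitMap f := by ext <;> simp
  right_unitMap f := by ext <;> simp
  unitMap_id A := by ext <;> simp
  unitMap_comp f g := by ext <;> simp [B.unitMap_comp, E.unitMap_comp]
  comp := CommaPro.comp
  compMap θ κ h := CommaCell.mk
    (B.compMap (CommaCell.base θ) (CommaCell.base κ) (congrArg CommaHom.base h))
    (E.compMap (CommaCell.total θ) (CommaCell.total κ) (congrArg CommaHom.total h))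
    (CommaCell.comp_w θ κ (congrArg CommaHom.base h) (congrArg CommaHom.total h))
  left_compMap θ κ h := by ext <;> simp
  right_compMap θ κ h := by ext <;> simp
  compMap_id m n := by ext <;> simp
  compMap_comp θ κ θ' κ' h h' := by
    ext
    · exact B.compMap_comp _ _ _ _ _ _
    · exact E.compMap_comp _ _ _ _ _ _
  assoc m n q :=
    { hom := CommaCell.mk (B.assoc _ _ _).hom (E.assoc _ _ _).hom (CommaCell.assoc_w m n q)
      inv := CommaCell.mk (B.assoc _ _ _).inv (E.assoc _ _ _).inv (CommaCell.assoc_inv_w m n q)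
      hom_inv_id := by ext <;> simp
      inv_hom_id := by ext <;> simp }
  left_assoc m n q := by ext <;> simp
  right_assoc m n q := by ext <;> simp
  assoc_naturality θ κ ρ h k := by
    ext
    · exact B.assoc_naturality _ _ _ _ _
    · exact E.assoc_naturality _ _ _ _ _
  pentagon m n q r := by
    ext
    · exact B.pentagon _ _ _ _
    · exact E.pentagon _ _ _ _
  unit_comp := CommaPro.unit_comp
  comp_unit := CommaPro.comp_unit
  unit_compMap θ := by
    ext
    · simpa [CommaCell.eqToHom_base] using B.unit_compMap (CommaCell.base θ)
    · simpa [CommaCell.eqToHom_total] using E.unit_compMap (CommaCell.total θ)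
  compMap_unit θ := by
    ext
    · simpa [CommaCell.eqToHom_base] using B.compMap_unit (CommaCell.base θ)
    · simpa [CommaCell.eqToHom_total] using E.compMap_unit (CommaCell.total θ)
  triangle m n := by
    ext
    · simpa [CommaCell.eqToHom_base] using B.triangle m.base n.base
    · simpa [CommaCell.eqToHom_total] using E.triangle m.total n.total

namespace commaDbl

/-- The projection of the comma double category onto `E`. -/
abbrev toTotal : PseudoDoubleFunctor (commaDbl P) E where
  obj x := x.total
  map f := CommaHom.total f
  map_id _ := rfl
  map_comp _ _ := rfl
  pro m := m.total
  cell θ := CommaCell.total θ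
  cell_id _ := rfl
  cell_comp _ _ := rfl
  left_cell _ := rfl
  right_cell _ := rfl
  φ _ _ := Iso.refl _
  left_φ _ _ := E.left_id _
  right_φ _ _ := E.right_id _
  φ_naturality _ _ _ := (Category.comp_id _).trans (Category.id_comp _).symm
  ι _ := Iso.refl _
  left_ι _ := E.left_id _
  right_ι _ := E.right_id _
  ι_naturality _ := (Category.comp_id _).trans (Category.id_comp _).symm
  associativity m n q := by simp
  left_unitality m := by
    simp only [Iso.refl_hom, Dbl.compMap_id, Category.id_comp]
    exact CommaCell.eqToHom_total _
  right_unitality m := by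
    simp only [Iso.refl_hom, Dbl.compMap_id, Category.id_comp]
    exact CommaCell.eqToHom_total _

/-- The projection of the comma double category onto `B`. -/
abbrev toBase : PseudoDoubleFunctor (commaDbl P) B where
  obj x := x.base
  map f := CommaHom.base f
  map_id _ := rfl
  map_comp _ _ := rfl
  pro m := m.base
  cell θ := CommaCell.base θ
  cell_id _ := rfl
  cell_comp _ _ := rfl
  left_cell _ := rfl
  right_cell _ := rfl
  φ _ _ := Iso.refl _
  left_φ _ _ := B.left_id _
  right_φ _ _ := B.right_id _
  φ_naturality _ _ _ := (Category.comp_id _).trans (Category.id_comp _).symm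
  ι _ := Iso.refl _
  left_ι _ := B.left_id _
  right_ι _ := B.right_id _
  ι_naturality _ := (Category.comp_id _).trans (Category.id_comp _).symm
  associativity m n q := by simp
  left_unitality m := by
    simp only [Iso.refl_hom, Dbl.compMap_id, Category.id_comp]
    exact CommaCell.eqToHom_base _
  right_unitality m := by
    simp only [Iso.refl_hom, Dbl.compMap_id, Category.id_comp]
    exact CommaCell.eqToHom_base _

/-- The universal transformation, from the projection onto `B` to the projection onto `E` followed
by `P`. -/
def universal : toBase P ⟶ (toTotal P).comp P where
  app x := x.arr
  appPro m := m.cell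
  left_appPro m := m.left_cell
  right_appPro m := m.right_cell
  naturality f := CommaHom.w f
  naturality_cell θ := CommaCell.w θ
  unit x := by simp
  comp m n := by simp

end commaDbl

end Comma

/-! ### Internal fibrations are double fibrations -/

section

open Bicategory

lemma appPro_associator_hom {W X Y Z : Dbl.{v, u}} (F : W ⟶ X) (G : X ⟶ Y) (H : Y ⟶ Z)
    {A A' : W.Obj} (m : W.Pro A A') : Transformation.appPro (α_ F G H).hom m = 𝟙 _ :=
  (Transformation.eqToHom_appPro (PseudoDoubleFunctor.assoc F G H) m).trans (eqToHom_refl _ _)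

lemma appPro_associator_inv {W X Y Z : Dbl.{v, u}} (F : W ⟶ X) (G : X ⟶ Y) (H : Y ⟶ Z)
    {A A' : W.Obj} (m : W.Pro A A') : Transformation.appPro (α_ F G H).inv m = 𝟙 _ :=
  (Transformation.eqToHom_appPro (PseudoDoubleFunctor.assoc F G H).symm m).trans (eqToHom_refl _ _)

/-- The components at proarrows of a Cartesian 2-cell of `Dbl` are Cartesian: test the universal
property against the double functors out of the walking proarrow. -/
lemma isCartesianArrow_appPro {X E B : Dbl.{v, u}} {P : E ⟶ B} {e e' : X ⟶ E} {α : e' ⟶ e}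
    (H : ∀ ⦃Y : Dbl.{v, u}⦄ (x : Y ⟶ X) (e'' : Y ⟶ E) (ξ : e'' ⟶ x ≫ e)
      (γ : e'' ≫ P ⟶ x ≫ e' ≫ P), ξ ▷ P = γ ≫ x ◁ (α ▷ P) ≫ (α_ x e P).inv →
        ∃! ζ : e'' ⟶ x ≫ e', ζ ≫ x ◁ α = ξ ∧ ζ ▷ P ≫ (α_ x e' P).hom = γ)
    {A A' : X.Obj} (m : X.Pro A A') :
    IsCartesianArrow (PseudoDoubleFunctor.arrFunctor P) (Transformation.appPro α m) := by
  rw [isCartesianArrow_iff]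
  intro M ξ γ h
  obtain ⟨ζ, ⟨h₁, h₂⟩, hu⟩ := H (Y := walkingProarrow) (walkingProarrow.pick m)
    (walkingProarrow.pick M.pro) (walkingProarrow.ofCell ξ) (walkingProarrow.ofCell γ) (by
      apply walkingProarrow.hom_ext
      rw [Transformation.comp_appPro, Transformation.comp_appPro, appPro_associator_inv]
      exact h.trans (congrArg (γ ≫ ·) (Category.comp_id _).symm))
  refine ⟨Transformation.appPro ζ walkingProarrow.gen, ⟨?_, ?_⟩, ?_⟩
  · exact congrArg (fun t => Transformation.appPro t walkingProarrow.gen) h₁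
  · have := congrArg (fun t => Transformation.appPro t walkingProarrow.gen) h₂
    rw [Transformation.comp_appPro, appPro_associator_hom] at this
    exact (Category.comp_id _).symm.trans this
  · rintro κ ⟨h₃, h₄⟩
    have := hu (walkingProarrow.ofCell κ) ⟨by
      apply walkingProarrow.hom_ext
      exact h₃, by
      apply walkingProarrow.hom_ext
      rw [Transformation.comp_appPro, appPro_associator_hom]
      exact (Category.comp_id _).trans h₄⟩
    exact congrArg (fun t => Transformation.appPro t walkingProarrow.gen) this

/-- The lifting data of an internal fibration, read off at objects. -/
lemma isHomLift_app {X E B : Dbl.{v, u}} {P : E ⟶ B} {e e' : X ⟶ E} {b : X ⟶ B} {α : e' ⟶ e}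
    {β : b ⟶ e ≫ P} {h : e' ≫ P = b} (hα : α ▷ P = eqToHom h ≫ β) (A : X.Obj) :
    (PseudoDoubleFunctor.objFunctor P).IsHomLift (Transformation.app β A)
      (Transformation.app α A) := by
  subst h
  rw [eqToHom_refl, Category.id_comp] at hα
  subst hα
  exact .map _

/-- The lifting data of an internal fibration, read off at proarrows. -/
lemma isHomLift_appPro {X E B : Dbl.{v, u}} {P : E ⟶ B} {e e' : X ⟶ E} {b : X ⟶ B} {α : e' ⟶ e}
    {β : b ⟶ e ≫ P} {h : e' ≫ P = b} (hα : α ▷ P = eqToHom h ≫ β) {A A' : X.Obj}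
    (m : X.Pro A A') :
    (PseudoDoubleFunctor.arrFunctor P).IsHomLift (Transformation.appPro β m)
      (Transformation.appPro α m) := by
  subst h
  rw [eqToHom_refl, Category.id_comp] at hα
  subst hα
  exact .map _

end

namespace Transformation

variable {X E : Dbl.{v, u}} {F G : PseudoDoubleFunctor X E}

/-- The components of a transformation at a composable pair of proarrows. -/
abbrev appPair (α : Transformation F G) (x : X.Pair) : F.pairFunctor.obj x ⟶ G.pairFunctor.obj x :=
  Dbl.Pair.Hom.mk (α.appPro x.fst) (α.appPro x.snd)
    ((α.right_appPro _).trans (α.left_appPro _).symm)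

end Transformation

open Bicategory in
/-- The lifting data of an internal fibration, read off at composable pairs of proarrows. -/
lemma isHomLift_appPair {X E B : Dbl.{v, u}} {P : E ⟶ B} {e e' : X ⟶ E} {b : X ⟶ B} {α : e' ⟶ e}
    {β : b ⟶ e ≫ P} {h : e' ≫ P = b} (hα : α ▷ P = eqToHom h ≫ β) (x : X.Pair) :
    (PseudoDoubleFunctor.pairFunctor P).IsHomLift (Transformation.appPair β x)
      (Transformation.appPair (G := e) α x) := by
  subst h
  rw [eqToHom_refl, Category.id_comp] at hα
  subst hα
  exact Functor.IsHomLift.map (p := PseudoDoubleFunctor.pairFunctor P)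
    (Transformation.appPair (F := e') (G := e) α x)

namespace Transformation

variable {X E B : Dbl.{v, u}} {P : PseudoDoubleFunctor E B} {F G : PseudoDoubleFunctor X E}
  (α : Transformation F G)

/-- If the component at the unit proarrow of `A` is Cartesian, then so is the component at `A`:
lifting problems for the latter are turned into lifting problems for the former by the unit
functor `y`, which is a section of the source functor. -/
lemma isCartesianArrow_app (A : X.Obj)
    (h : IsCartesianArrow P.arrFunctor (α.appPro (X.unitPro A))) :
    IsCartesianArrow P.objFunctor (α.app A) := by
  rw [P.isCartesianArrow_map_iff]
  rw [P.isCartesianArrow_cell_iff] at h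
  intro Z ξ γ e
  have hγ : ∀ ζ : Z ⟶ F.obj A, P.map ζ = γ →
      P.cell (E.unitMap ζ ≫ (F.ι A).hom) =
        (P.ι Z).inv ≫ B.unitMap γ ≫ (P.ι (F.obj A)).hom ≫ P.cell (F.ι A).hom := by
    rintro ζ rfl
    rw [reassoc_of% (P.ι_naturality ζ), Iso.inv_hom_id_assoc, P.cell_comp]
  obtain ⟨ζ, ⟨h₁, h₂⟩, hu⟩ := h (q := ProArrow.of (E.unitPro Z))
    (E.unitMap ξ ≫ (G.ι A).hom)
    ((P.ι Z).inv ≫ B.unitMap γ ≫ (P.ι (F.obj A)).hom ≫ P.cell (F.ι A).hom) (by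
      simp only [Category.assoc]
      rw [← P.cell_comp, ← α.unit A, P.cell_comp (E.unitMap (α.app A)),
        ← reassoc_of% (P.ι_naturality (α.app A)),
        ← Category.assoc (B.unitMap γ), ← B.unitMap_comp, ← e, reassoc_of% (P.ι_naturality ξ),
        Iso.inv_hom_id_assoc, P.cell_comp])
  refine ⟨E.left ζ, ⟨?_, ?_⟩, ?_⟩
  · have := congrArg E.left h₁
    simpa using this
  · have := congrArg B.left h₂
    simpa using this
  · rintro κ ⟨h₃, h₄⟩
    have := congrArg E.left (hu (E.unitMap κ ≫ (F.ι A).hom) ⟨by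
      rw [Category.assoc, ← α.unit A, ← Category.assoc, ← E.unitMap_comp, h₃], hγ κ h₄⟩)
    simpa using this

lemma isCartesianArrow_unitMap_app (A : X.Obj)
    (h : IsCartesianArrow P.arrFunctor (α.appPro (X.unitPro A))) :
    IsCartesianArrow P.arrFunctor (E.unitMap (α.app A)) := by
  have e : E.unitMap (α.app A) = (F.ι A).hom ≫ α.appPro (X.unitPro A) ≫ (G.ι A).inv := by
    rw [← reassoc_of% α.unit A, Iso.hom_inv_id, Category.comp_id]
  rw [e]
  exact IsCartesianArrow.comp (.of_isIso _) (h.comp (.of_isIso _))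

lemma isCartesianArrow_compMap_appPro (x : X.Pair)
    (h : IsCartesianArrow P.arrFunctor (α.appPro (X.comp x.fst x.snd))) :
    IsCartesianArrow P.arrFunctor (E.compFunctor.map (α.appPair x)) := by
  have e : E.compFunctor.map (α.appPair x) =
      (F.φ x.fst x.snd).hom ≫ α.appPro (X.comp x.fst x.snd) ≫ (G.φ x.fst x.snd).inv := by
    rw [← reassoc_of% α.comp x.fst x.snd, Iso.hom_inv_id]
    exact (Category.comp_id _).symm
  rw [e]
  exact IsCartesianArrow.comp (.of_isIso (F.φ x.fst x.snd).hom)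
    (h.comp (.of_isIso (G.φ x.fst x.snd).inv))

end Transformation

lemma Cleavage.isFibered {𝒳 𝒮 : Type*} [Category* 𝒳] [Category* 𝒮] {p : 𝒳 ⥤ 𝒮} (c : Cleavage p) :
    p.IsFibered :=
  .of_exists_isStronglyCartesian fun _ _ w => ⟨c.obj w, c.map w, c.isStronglyCartesian w⟩

/-- The Cartesian lift of the universal transformation of the comma double category provides
cleavages of `P₀` and `P₁` at once. -/
theorem definesDoubleFibration_of_isInternalFibration {E B : Dbl.{v, max v u}} (P : E ⟶ B)
    (h : IsInternalFibration P) : DefinesDoubleFibration P := by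
  obtain ⟨e', α, hb, hα, H⟩ := h (X := commaDbl P) (commaDbl.toTotal P) (commaDbl.toBase P)
    (commaDbl.universal P)
  have cartPro : ∀ {x y : CommaObj P} (m : CommaPro x y),
      IsCartesianArrow (PseudoDoubleFunctor.arrFunctor P) (Transformation.appPro α m) :=
    fun m => isCartesianArrow_appPro H m
  have cart : ∀ x : CommaObj P,
      IsCartesianArrow (PseudoDoubleFunctor.objFunctor P) (Transformation.app α x) :=
    fun x => Transformation.isCartesianArrow_app α x (cartPro _)
  have lift : ∀ x : CommaObj P, (PseudoDoubleFunctor.objFunctor P).IsHomLift x.arr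
      (Transformation.app α x) := fun x => isHomLift_app hα x
  have liftPro : ∀ {x y : CommaObj P} (m : CommaPro x y),
      (PseudoDoubleFunctor.arrFunctor P).IsHomLift m.cell (Transformation.appPro α m) :=
    fun m => isHomLift_appPro hα m
  let src {m : B.Arr} {M : E.Arr} (w : m ⟶ (PseudoDoubleFunctor.arrFunctor P).obj M) :
    CommaObj P := ⟨m.src, M.src, B.left w⟩
  let tgt {m : B.Arr} {M : E.Arr} (w : m ⟶ (PseudoDoubleFunctor.arrFunctor P).obj M) :
    CommaObj P := ⟨m.tgt, M.tgt, B.right w⟩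
  let pro {m : B.Arr} {M : E.Arr} (w : m ⟶ (PseudoDoubleFunctor.arrFunctor P).obj M) :
    CommaPro (src w) (tgt w) := ⟨m.pro, M.pro, w, rfl, rfl⟩
  let c₀ : Cleavage (PseudoDoubleFunctor.objFunctor P) :=
    { obj := fun {b} {a} w => e'.obj (CommaObj.mk b a w)
      map := fun {b} {a} w => Transformation.app α (CommaObj.mk b a w)
      isStronglyCartesian := fun {b} {a} w =>
        (cart (CommaObj.mk b a w)).isStronglyCartesian w (hw := lift (CommaObj.mk b a w)) }
  let c₁ : Cleavage (PseudoDoubleFunctor.arrFunctor P) :=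
    { obj := fun w => ProArrow.of (e'.pro (pro w))
      map := fun w => Transformation.appPro α (pro w)
      isStronglyCartesian := fun w =>
        (cartPro (pro w)).isStronglyCartesian w (hw := liftPro (pro w)) }
  refine ⟨c₀.isFibered, c₁.isFibered, ⟨c₀, c₁, ?_, ?_⟩, ?_, ?_⟩
  · rintro _ _ _ ⟨w⟩
    have e : E.left (Transformation.appPro α (pro w)) = c₀.map (B.left w) :=
      Transformation.left_appPro α (pro w)
    change c₀.Chosen (E.left (Transformation.appPro α (pro w)))
    rw [e]
    exact .lift _
  · rintro _ _ _ ⟨w⟩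
    have e : E.right (Transformation.appPro α (pro w)) = c₀.map (B.right w) :=
      Transformation.right_appPro α (pro w)
    change c₀.Chosen (E.right (Transformation.appPro α (pro w)))
    rw [e]
    exact .lift _
  · refine preservesCartesian_of_exists fun b y w => ⟨_, Transformation.app α (CommaObj.mk b y w),
      lift (CommaObj.mk b y w), cart _, ?_⟩
    exact Transformation.isCartesianArrow_unitMap_app α (CommaObj.mk b y w) (cartPro _)
  · refine preservesCartesian_of_exists fun b y w => ?_
    -- The two cells of `w` share their boundary `B.right w.fst`, so they form a composable pair of
    -- proarrows in the comma double category.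
    let m : CommaPro ⟨b.A, y.A, B.left (Dbl.Pair.Hom.fst w)⟩
        ⟨b.B, y.B, B.right (Dbl.Pair.Hom.fst w)⟩ :=
      ⟨b.fst, y.fst, Dbl.Pair.Hom.fst w, rfl, rfl⟩
    let n : CommaPro ⟨b.B, y.B, B.right (Dbl.Pair.Hom.fst w)⟩
        ⟨b.D, y.D, B.right (Dbl.Pair.Hom.snd w)⟩ :=
      ⟨b.snd, y.snd, Dbl.Pair.Hom.snd w, (Dbl.Pair.Hom.w w).symm, rfl⟩
    let x : (commaDbl P).Pair := ⟨m, n⟩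
    refine ⟨_, Transformation.appPair α x, isHomLift_appPair hα x, ?_,
      Transformation.isCartesianArrow_compMap_appPro α x (cartPro _)⟩
    refine PseudoDoubleFunctor.isCartesianArrow_pair _ _ (cartPro m) (cartPro n) ?_
    have e : E.right (Transformation.appPro α m) = _ := Transformation.right_appPro α m
    change IsCartesianArrow _ (E.right (Transformation.appPro α m))
    rw [e]
    exact cart _

/-! ### Transformations with Cartesian components are Cartesian 2-cells -/

namespace Transformation

variable {Y X E B : Dbl.{v, u}} {P : PseudoDoubleFunctor E B}

/-- A lifting problem for transformations can be solved componentwise through a transformation with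
Cartesian components; the axioms for the solution follow from the uniqueness of the lifts. -/
lemma exists_lift {F G : PseudoDoubleFunctor Y E} (α : Transformation F G)
    (h₀ : ∀ A, IsCartesianArrow P.objFunctor (α.app A))
    (h₁ : ∀ {A A' : Y.Obj} (m : Y.Pro A A'), IsCartesianArrow P.arrFunctor (α.appPro m))
    {K : PseudoDoubleFunctor Y E} (ξ : Transformation K G)
    (γ : Transformation (K.comp P) (F.comp P))
    (e₀ : ∀ A, P.map (ξ.app A) = γ.app A ≫ P.map (α.app A))
    (e₁ : ∀ {A A' : Y.Obj} (m : Y.Pro A A'),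
      P.cell (ξ.appPro m) = γ.appPro m ≫ P.cell (α.appPro m)) :
    ∃ ζ : Transformation K F, (∀ A, ζ.app A ≫ α.app A = ξ.app A ∧ P.map (ζ.app A) = γ.app A) ∧
      ∀ {A A' : Y.Obj} (m : Y.Pro A A'), ζ.appPro m ≫ α.appPro m = ξ.appPro m ∧
        P.cell (ζ.appPro m) = γ.appPro m := by
  have H₀ := fun A => ((P.isCartesianArrow_map_iff _).1 (h₀ A) _ _ (e₀ A)).exists
  have H₁ := fun {A A' : Y.Obj} (m : Y.Pro A A') =>
    ((P.isCartesianArrow_cell_iff _).1 (h₁ m) _ _ (e₁ m)).exists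
  choose ζ₀ hζ₀ hζ₀' using H₀
  choose ζ₁ hζ₁ hζ₁' using @H₁
  have ext₀ : ∀ {Z : E.Obj} {A : Y.Obj} {f g : Z ⟶ F.obj A},
      f ≫ α.app A = g ≫ α.app A → P.map f = P.map g → f = g :=
    fun h h' => (h₀ _).hom_ext h h'
  have ext₁ : ∀ {q : E.Arr} {A A' : Y.Obj} {m : Y.Pro A A'} {f g : q ⟶ ProArrow.of (F.pro m)},
      f ≫ α.appPro m = g ≫ α.appPro m → P.cell f = P.cell g → f = g :=
    fun h h' => (h₁ _).hom_ext h h'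
  have left : ∀ {A A' : Y.Obj} (m : Y.Pro A A'), E.left (ζ₁ m) = ζ₀ A := fun m => by
    apply ext₀
    · have := congrArg E.left (hζ₁ m)
      simpa [hζ₀] using this
    · rw [← P.left_cell, hζ₁', hζ₀', γ.left_appPro]
  have right : ∀ {A A' : Y.Obj} (m : Y.Pro A A'), E.right (ζ₁ m) = ζ₀ A' := fun m => by
    apply ext₀
    · have := congrArg E.right (hζ₁ m)
      simpa [hζ₀] using this
    · rw [← P.right_cell, hζ₁', hζ₀', γ.right_appPro]
  refine ⟨
    { app := ζ₀
      appPro := ζ₁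
      left_appPro := left
      right_appPro := right
      naturality := fun f => ?_
      naturality_cell := fun θ => ?_
      unit := fun A => ?_
      comp := fun m n => ?_ }, fun A => And.intro (hζ₀ A) (hζ₀' A),
    fun m => And.intro (hζ₁ m) (hζ₁' m)⟩
  · apply ext₀
    · rw [Category.assoc, hζ₀, ξ.naturality, Category.assoc, α.naturality, reassoc_of% hζ₀]
    · rw [P.map_comp, P.map_comp, hζ₀', hζ₀']
      exact γ.naturality f
  · apply ext₁
    · rw [Category.assoc, hζ₁, ξ.naturality_cell, Category.assoc, α.naturality_cell,
        reassoc_of% hζ₁]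
    · rw [P.cell_comp, P.cell_comp, hζ₁', hζ₁']
      exact γ.naturality_cell θ
  · apply ext₁
    · rw [Category.assoc, ← α.unit, Category.assoc, hζ₁, ← ξ.unit, ← Category.assoc,
        ← E.unitMap_comp, hζ₀]
    · have := γ.unit A
      simp only [Iso.trans_hom, PseudoDoubleFunctor.cellIso_hom, Category.assoc] at this
      rw [← cancel_epi (P.ι (K.obj A)).hom, P.cell_comp, P.cell_comp, hζ₁', ← this,
        ← reassoc_of% (P.ι_naturality (ζ₀ A)), hζ₀']
  · have w : E.right (ζ₁ m) = E.left (ζ₁ n) := by rw [left, right]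
    apply ext₁
    · rw [Category.assoc, ← α.comp, Category.assoc, hζ₁, ← ξ.comp, ← Category.assoc,
        ← E.compMap_comp _ _ _ _ w (by simp),
        E.compMap_congr _ (hζ₁ m) (hζ₁ n)]
    · have := γ.comp m n
      simp only [Iso.trans_hom, PseudoDoubleFunctor.cellIso_hom, Category.assoc] at this
      rw [← cancel_epi (P.φ (K.pro m) (K.pro n)).hom, P.cell_comp, P.cell_comp, hζ₁', ← this,
        ← reassoc_of% (P.φ_naturality (ζ₁ m) (ζ₁ n) w),
        B.compMap_congr _ (hζ₁' m) (hζ₁' n)]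

end Transformation

open Bicategory in
/-- A transformation whose components are Cartesian is a Cartesian 2-cell of `Dbl`. -/
lemma existsUnique_lift_of_isCartesianArrow {Y X E B : Dbl.{v, u}} {P : E ⟶ B} {e e' : X ⟶ E}
    (α : e' ⟶ e)
    (h₀ : ∀ A, IsCartesianArrow (PseudoDoubleFunctor.objFunctor P) (Transformation.app α A))
    (h₁ : ∀ {A A' : X.Obj} (m : X.Pro A A'),
      IsCartesianArrow (PseudoDoubleFunctor.arrFunctor P) (Transformation.appPro α m))
    (x : Y ⟶ X) (e'' : Y ⟶ E) (ξ : e'' ⟶ x ≫ e) (γ : e'' ≫ P ⟶ x ≫ e' ≫ P)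
    (h : ξ ▷ P = γ ≫ x ◁ (α ▷ P) ≫ (α_ x e P).inv) :
    ∃! ζ : e'' ⟶ x ≫ e', ζ ≫ x ◁ α = ξ ∧ ζ ▷ P ≫ (α_ x e' P).hom = γ := by
  have e : ξ ▷ P = (γ ≫ (α_ x e' P).inv) ≫ (x ◁ α) ▷ P := by
    rw [h, whisker_assoc]
    simp
  obtain ⟨ζ, hζ₀, hζ₁⟩ := Transformation.exists_lift (P := P)
    (Transformation.whiskerLeft x α) (fun A => h₀ _) (fun m => h₁ _) ξ (γ ≫ (α_ x e' P).inv)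
    (fun A => congrArg (fun t => Transformation.app t A) e)
    (fun m => congrArg (fun t => Transformation.appPro t m) e)
  · refine ⟨ζ, ⟨Transformation.hom_ext (fun A => (hζ₀ A).1) (fun m => (hζ₁ m).1), ?_⟩, ?_⟩
    · rw [← Iso.eq_comp_inv]
      exact Transformation.hom_ext (fun A => (hζ₀ A).2) (fun m => (hζ₁ m).2)
    · rintro κ ⟨h₃, h₄⟩
      rw [← Iso.eq_comp_inv] at h₄
      subst h₃
      refine Transformation.hom_ext (fun A => ?_) (fun m => ?_)
      · refine (h₀ _).hom_ext (hζ₀ A).1.symm ?_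
        exact (congrArg (fun t => Transformation.app t A) h₄).trans (hζ₀ A).2.symm
      · refine (h₁ _).hom_ext (hζ₁ m).1.symm ?_
        exact (congrArg (fun t => Transformation.appPro t m) h₄).trans (hζ₁ m).2.symm

/-! ### Lifting double functors along a double fibration -/

lemma IsCartesianArrow.exists_iso {𝒳 𝒮 : Type*} [Category* 𝒳] [Category* 𝒮] {p : 𝒳 ⥤ 𝒮}
    {x y z : 𝒳} {f : x ⟶ y} {f' : z ⟶ y} (hf : IsCartesianArrow p f) (hf' : IsCartesianArrow p f')
    {R S T : 𝒮} (g : R ≅ S) (w : S ⟶ T) (hw : p.IsHomLift w f)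
    (h : p.IsHomLift (g.hom ≫ w) f') :
    ∃ ζ : z ≅ x, p.IsHomLift g.hom ζ.hom ∧ ζ.hom ≫ f = f' := by
  have := hf.isStronglyCartesian w
  have := hf'.isStronglyCartesian (g.hom ≫ w)
  exact ⟨Functor.IsStronglyCartesian.domainIsoOfBaseIso p (f := w) (g := g) rfl f f',
    inferInstance, by
    rw [Functor.IsStronglyCartesian.domainIsoOfBaseIso_hom, Functor.IsStronglyCartesian.fac]⟩

/-- A double functor `F` whose values on arrows, cells and comparison cells lift those of `b` along
a strict double functor `P` is a lift of `b`. -/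
lemma PseudoDoubleFunctor.IsStrict.comp_eq_of_isHomLift {X E B : Dbl.{v, u}}
    {P : PseudoDoubleFunctor E B} (hP : P.IsStrict) {F : PseudoDoubleFunctor X E}
    {b : PseudoDoubleFunctor X B}
    (hmap : ∀ {A A' : X.Obj} (f : A ⟶ A'), P.objFunctor.IsHomLift (b.map f) (F.map f))
    (hcell : ∀ {m n : X.Arr} (θ : m ⟶ n), P.arrFunctor.IsHomLift (b.cell θ) (F.cell θ))
    (hφ : ∀ {A A' A'' : X.Obj} (m : X.Pro A A') (n : X.Pro A' A''),
      P.arrFunctor.IsHomLift (b.φ m n).hom (F.φ m n).hom)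
    (hι : ∀ A : X.Obj, P.arrFunctor.IsHomLift (b.ι A).hom (F.ι A).hom) :
    F.comp P = b := by
  have hobj : ∀ A, P.obj (F.obj A) = b.obj A := fun A =>
    have := hmap (𝟙 A)
    IsHomLift.domain_eq P.objFunctor (b.map (𝟙 A)) (F.map (𝟙 A))
  have hpro : ∀ {A A' : X.Obj} (m : X.Pro A A'),
      ProArrow.of (P.pro (F.pro m)) = ProArrow.of (b.pro m) := fun m =>
    have := hcell (𝟙 (ProArrow.of m))
    IsHomLift.domain_eq P.arrFunctor (b.cell (𝟙 (ProArrow.of m))) (F.cell (𝟙 (ProArrow.of m)))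
  obtain ⟨obj, map, _, _, pro, cell, _, _, _, _, φ, _, _, _, ι, _, _, _, _, _, _⟩ := b
  obtain rfl : (fun A => P.obj (F.obj A)) = obj := funext hobj
  obtain rfl : (fun {A A'} m => P.pro (F.pro m)) = @pro := by
    funext A A' m
    exact ProArrow.of_injective (hpro m)
  refine PseudoDoubleFunctor.ext rfl (heq_of_eq ?_) HEq.rfl (heq_of_eq ?_) (heq_of_eq ?_)
    (heq_of_eq ?_)
  · funext A A' f
    exact P.map_eq_of_isHomLift (hmap f)
  · funext m n θ
    exact P.cell_eq_of_isHomLift (hcell θ)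
  · funext A A' A'' m n
    apply Iso.ext
    have e := P.eq_of_isHomLift_cell (hφ m n) (congrArg ProArrow.of (hP.pro_comp _ _)) rfl
    refine Eq.trans ?_ e.symm
    rw [Iso.trans_hom, hP.φ_eq]
    exact congrArg (eqToHom _ ≫ ·) (Category.comp_id _).symm
  · funext A
    apply Iso.ext
    have e := P.eq_of_isHomLift_cell (hι A) (congrArg ProArrow.of (hP.pro_unit _)) rfl
    refine Eq.trans ?_ e.symm
    rw [Iso.trans_hom, hP.ι_eq]
    exact congrArg (eqToHom _ ≫ ·) (Category.comp_id _).symm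

/-- Cartesian lifts `α` of the components of a transformation `β : b ⟶ e ≫ P`, chosen compatibly
with source and target and such that units and external composites of the chosen lifts are again
Cartesian. -/
structure CartesianLifts {X E B : Dbl.{v, u}} (P : PseudoDoubleFunctor E B)
    (e : PseudoDoubleFunctor X E) {b : PseudoDoubleFunctor X B}
    (β : Transformation b (e.comp P)) where
  obj (A : X.Obj) : E.Obj
  app (A : X.Obj) : obj A ⟶ e.obj A
  pro {A A' : X.Obj} (m : X.Pro A A') : E.Pro (obj A) (obj A')
  appPro {A A' : X.Obj} (m : X.Pro A A') : ProArrow.of (pro m) ⟶ ProArrow.of (e.pro m)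
  left_appPro {A A' : X.Obj} (m : X.Pro A A') : E.left (appPro m) = app A
  right_appPro {A A' : X.Obj} (m : X.Pro A A') : E.right (appPro m) = app A'
  lift_app (A : X.Obj) : P.objFunctor.IsHomLift (β.app A) (app A)
  lift_appPro {A A' : X.Obj} (m : X.Pro A A') : P.arrFunctor.IsHomLift (β.appPro m) (appPro m)
  cart_app (A : X.Obj) : IsCartesianArrow P.objFunctor (app A)
  cart_appPro {A A' : X.Obj} (m : X.Pro A A') : IsCartesianArrow P.arrFunctor (appPro m)
  cart_unit (A : X.Obj) : IsCartesianArrow P.arrFunctor (E.unitMap (app A))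
  cart_comp {A A' A'' : X.Obj} (m : X.Pro A A') (n : X.Pro A' A'') :
    IsCartesianArrow P.arrFunctor (E.compMap (appPro m) (appPro n)
      ((right_appPro m).trans (left_appPro n).symm))

namespace CartesianLifts

attribute [simp] left_appPro right_appPro

variable {X E B : Dbl.{v, u}} {P : PseudoDoubleFunctor E B} {e : PseudoDoubleFunctor X E}
  {b : PseudoDoubleFunctor X B} {β : Transformation b (e.comp P)} (L : CartesianLifts P e β)

lemma obj_eq (A : X.Obj) : P.obj (L.obj A) = b.obj A :=
  have := L.lift_app A
  IsHomLift.domain_eq P.objFunctor (β.app A) (L.app A)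

lemma pro_eq {A A' : X.Obj} (m : X.Pro A A') :
    ProArrow.of (P.pro (L.pro m)) = ProArrow.of (b.pro m) :=
  have := L.lift_appPro m
  IsHomLift.domain_eq P.arrFunctor (β.appPro m) (L.appPro m)

lemma exists_map {A A' : X.Obj} (f : A ⟶ A') : ∃ g : L.obj A ⟶ L.obj A',
    P.objFunctor.IsHomLift (b.map f) g ∧ g ≫ L.app A' = L.app A ≫ e.map f := by
  refine (L.cart_app A').exists_isHomLift _ (b.map f) (β.app A') (L.lift_app A') ?_
  rw [β.naturality]
  have := L.lift_app A
  have : P.objFunctor.IsHomLift ((e.comp P).map f) (e.map f) := .map _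
  infer_instance

lemma exists_cell {m n : X.Arr} (θ : m ⟶ n) :
    ∃ κ : ProArrow.of (L.pro m.pro) ⟶ ProArrow.of (L.pro n.pro),
      P.arrFunctor.IsHomLift (b.cell θ) κ ∧ κ ≫ L.appPro n.pro = L.appPro m.pro ≫ e.cell θ := by
  refine (L.cart_appPro n.pro).exists_isHomLift _ (b.cell θ) (β.appPro n.pro)
    (L.lift_appPro n.pro) ?_
  rw [β.naturality_cell]
  have := L.lift_appPro m.pro
  have : P.arrFunctor.IsHomLift ((e.comp P).cell θ) (e.cell θ) := .map (p := P.arrFunctor) _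
  infer_instance

variable (hP : P.IsStrict)
include hP

/-- The composite of the chosen lifts at `m` and `n` and the chosen lift at their composite are
Cartesian, so that they differ by an invertible cell over `b.φ m n`. -/
lemma exists_φ {A A' A'' : X.Obj} (m : X.Pro A A') (n : X.Pro A' A'') :
    ∃ κ : ProArrow.of (E.comp (L.pro m) (L.pro n)) ≅ ProArrow.of (L.pro (X.comp m n)),
      P.arrFunctor.IsHomLift (b.φ m n).hom κ.hom ∧ κ.hom ≫ L.appPro (X.comp m n) =
        E.compMap (L.appPro m) (L.appPro n) (by simp) ≫ (e.φ m n).hom := by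
  refine (L.cart_appPro (X.comp m n)).exists_iso ((L.cart_comp m n).comp (.of_isIso (e.φ m n).hom))
    (b.φ m n) (β.appPro (X.comp m n)) (L.lift_appPro _) ?_
  rw [← β.comp m n]
  have := hP.isHomLift_compMap (L.lift_appPro m) (L.lift_appPro n) (by simp) (by simp)
  have : P.arrFunctor.IsHomLift ((e.comp P).φ m n).hom (e.φ m n).hom := by
    rw [Iso.trans_hom, hP.φ_eq, IsHomLift.lift_eqToHom_comp_iff]
    exact .map (p := P.arrFunctor) _
  infer_instance

/-- The unit of the chosen lift at `A` and the chosen lift at the unit of `A` are Cartesian, so that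
they differ by an invertible cell over `b.ι A`. -/
lemma exists_ι (A : X.Obj) :
    ∃ κ : ProArrow.of (E.unitPro (L.obj A)) ≅ ProArrow.of (L.pro (X.unitPro A)),
      P.arrFunctor.IsHomLift (b.ι A).hom κ.hom ∧ κ.hom ≫ L.appPro (X.unitPro A) =
        E.unitMap (L.app A) ≫ (e.ι A).hom := by
  refine (L.cart_appPro (X.unitPro A)).exists_iso ((L.cart_unit A).comp (.of_isIso (e.ι A).hom))
    (b.ι A) (β.appPro (X.unitPro A)) (L.lift_appPro _) ?_
  rw [← β.unit A]
  have := hP.isHomLift_unitMap (L.lift_app A)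
  have : P.arrFunctor.IsHomLift ((e.comp P).ι A).hom (e.ι A).hom := by
    rw [Iso.trans_hom, hP.ι_eq, IsHomLift.lift_eqToHom_comp_iff]
    exact .map (p := P.arrFunctor) _
  infer_instance

end CartesianLifts

namespace CartesianLifts

variable {X E B : Dbl.{v, u}} {P : PseudoDoubleFunctor E B} {e : PseudoDoubleFunctor X E}
  {b : PseudoDoubleFunctor X B} {β : Transformation b (e.comp P)} (L : CartesianLifts P e β)

/-- The unique lift of `b.map f` compatible with the Cartesian lifts. -/
noncomputable def map {A A' : X.Obj} (f : A ⟶ A') : L.obj A ⟶ L.obj A' := (L.exists_map f).choose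

lemma lift_map {A A' : X.Obj} (f : A ⟶ A') : P.objFunctor.IsHomLift (b.map f) (L.map f) :=
  (L.exists_map f).choose_spec.1

lemma map_app {A A' : X.Obj} (f : A ⟶ A') : L.map f ≫ L.app A' = L.app A ≫ e.map f :=
  (L.exists_map f).choose_spec.2

/-- The unique lift of `b.cell θ` compatible with the Cartesian lifts. -/
noncomputable def cell {m n : X.Arr} (θ : m ⟶ n) :
    ProArrow.of (L.pro m.pro) ⟶ ProArrow.of (L.pro n.pro) := (L.exists_cell θ).choose

lemma lift_cell {m n : X.Arr} (θ : m ⟶ n) : P.arrFunctor.IsHomLift (b.cell θ) (L.cell θ) :=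
  (L.exists_cell θ).choose_spec.1

lemma cell_appPro {m n : X.Arr} (θ : m ⟶ n) :
    L.cell θ ≫ L.appPro n.pro = L.appPro m.pro ≫ e.cell θ :=
  (L.exists_cell θ).choose_spec.2

section

variable (hP : P.IsStrict)

/-- The unique lift of the comparison cell `b.φ m n` compatible with the Cartesian lifts. -/
noncomputable def φ {A A' A'' : X.Obj} (m : X.Pro A A') (n : X.Pro A' A'') :
    ProArrow.of (E.comp (L.pro m) (L.pro n)) ≅ ProArrow.of (L.pro (X.comp m n)) :=
  (L.exists_φ hP m n).choose

lemma lift_φ {A A' A'' : X.Obj} (m : X.Pro A A') (n : X.Pro A' A'') :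
    P.arrFunctor.IsHomLift (b.φ m n).hom (L.φ hP m n).hom :=
  (L.exists_φ hP m n).choose_spec.1

lemma φ_appPro {A A' A'' : X.Obj} (m : X.Pro A A') (n : X.Pro A' A'') :
    (L.φ hP m n).hom ≫ L.appPro (X.comp m n) =
      E.compMap (L.appPro m) (L.appPro n) (by simp) ≫ (e.φ m n).hom :=
  (L.exists_φ hP m n).choose_spec.2

/-- The unique lift of the comparison cell `b.ι A` compatible with the Cartesian lifts. -/
noncomputable def ι (A : X.Obj) :
    ProArrow.of (E.unitPro (L.obj A)) ≅ ProArrow.of (L.pro (X.unitPro A)) :=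
  (L.exists_ι hP A).choose

lemma lift_ι (A : X.Obj) : P.arrFunctor.IsHomLift (b.ι A).hom (L.ι hP A).hom :=
  (L.exists_ι hP A).choose_spec.1

lemma ι_appPro (A : X.Obj) :
    (L.ι hP A).hom ≫ L.appPro (X.unitPro A) = E.unitMap (L.app A) ≫ (e.ι A).hom :=
  (L.exists_ι hP A).choose_spec.2

end

lemma ext_app {A : X.Obj} {Z : E.Obj} {f g : Z ⟶ L.obj A} {R S : B.Obj} (w : R ⟶ S)
    (hf : P.objFunctor.IsHomLift w f) (hg : P.objFunctor.IsHomLift w g)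
    (h : f ≫ L.app A = g ≫ L.app A) : f = g :=
  (L.cart_app A).eq_of_isHomLift w hf hg h

lemma ext_appPro {A A' : X.Obj} {m : X.Pro A A'} {q : E.Arr} {f g : q ⟶ ProArrow.of (L.pro m)}
    {R S : B.Arr} (w : R ⟶ S) (hf : P.arrFunctor.IsHomLift w f)
    (hg : P.arrFunctor.IsHomLift w g) (h : f ≫ L.appPro m = g ≫ L.appPro m) : f = g :=
  (L.cart_appPro m).eq_of_isHomLift w hf hg h

lemma lift_id (A : X.Obj) : P.objFunctor.IsHomLift (𝟙 (b.obj A)) (𝟙 (L.obj A)) :=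
  IsHomLift.id (L.obj_eq A)

lemma lift_id_pro {A A' : X.Obj} (m : X.Pro A A') :
    P.arrFunctor.IsHomLift (𝟙 (ProArrow.of (b.pro m))) (𝟙 (ProArrow.of (L.pro m))) :=
  IsHomLift.id (L.pro_eq m)

lemma map_id (A : X.Obj) : L.map (𝟙 A) = 𝟙 _ :=
  L.ext_app (b.map (𝟙 A)) (L.lift_map _) (b.map_id A ▸ L.lift_id A) (by simp [map_app])

lemma map_comp {A A' A'' : X.Obj} (f : A ⟶ A') (g : A' ⟶ A'') :
    L.map (f ≫ g) = L.map f ≫ L.map g := by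
  refine L.ext_app (b.map (f ≫ g)) (L.lift_map _) ?_ ?_
  · have := L.lift_map f
    have := L.lift_map g
    rw [b.map_comp]
    infer_instance
  · rw [Category.assoc, map_app, map_app, e.map_comp, ← Category.assoc, ← Category.assoc, map_app]

lemma cell_id (m : X.Arr) : L.cell (𝟙 m) = 𝟙 _ :=
  L.ext_appPro (b.cell (𝟙 m)) (L.lift_cell _) (b.cell_id m ▸ L.lift_id_pro m.pro)
    (by simp [cell_appPro])

lemma cell_comp {m n q : X.Arr} (θ : m ⟶ n) (κ : n ⟶ q) :
    L.cell (θ ≫ κ) = L.cell θ ≫ L.cell κ := by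
  refine L.ext_appPro (b.cell (θ ≫ κ)) (L.lift_cell _) ?_ ?_
  · have := L.lift_cell θ
    have := L.lift_cell κ
    rw [b.cell_comp]
    infer_instance
  · rw [Category.assoc, cell_appPro, cell_appPro, e.cell_comp, ← Category.assoc, ← Category.assoc,
      cell_appPro]

lemma left_cell {m n : X.Arr} (θ : m ⟶ n) : E.left (L.cell θ) = L.map (X.left θ) := by
  refine L.ext_app (b.map (X.left θ)) (b.left_cell θ ▸ P.isHomLift_left (L.lift_cell θ))
    (L.lift_map _) ?_
  have h := congrArg E.left (L.cell_appPro θ)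
  simp only [Dbl.left_comp, left_appPro, PseudoDoubleFunctor.left_cell] at h
  rw [h, map_app]

lemma right_cell {m n : X.Arr} (θ : m ⟶ n) : E.right (L.cell θ) = L.map (X.right θ) := by
  refine L.ext_app (b.map (X.right θ)) (b.right_cell θ ▸ P.isHomLift_right (L.lift_cell θ))
    (L.lift_map _) ?_
  have h := congrArg E.right (L.cell_appPro θ)
  simp only [Dbl.right_comp, right_appPro, PseudoDoubleFunctor.right_cell] at h
  rw [h, map_app]

variable (hP : P.IsStrict)
include hP

lemma left_φ {A A' A'' : X.Obj} (m : X.Pro A A') (n : X.Pro A' A'') :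
    E.left (L.φ hP m n).hom = 𝟙 _ := by
  refine L.ext_app _ (b.left_φ m n ▸ P.isHomLift_left (L.lift_φ hP m n)) (L.lift_id A) ?_
  have h := congrArg E.left (L.φ_appPro hP m n)
  simp at h
  simp [h]

lemma right_φ {A A' A'' : X.Obj} (m : X.Pro A A') (n : X.Pro A' A'') :
    E.right (L.φ hP m n).hom = 𝟙 _ := by
  refine L.ext_app _ (b.right_φ m n ▸ P.isHomLift_right (L.lift_φ hP m n)) (L.lift_id A'') ?_
  have h := congrArg E.right (L.φ_appPro hP m n)
  simp at h
  simp [h]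

lemma left_ι (A : X.Obj) : E.left (L.ι hP A).hom = 𝟙 _ := by
  refine L.ext_app _ (b.left_ι A ▸ P.isHomLift_left (L.lift_ι hP A)) (L.lift_id A) ?_
  have h := congrArg E.left (L.ι_appPro hP A)
  simp at h
  simp [h]

lemma right_ι (A : X.Obj) : E.right (L.ι hP A).hom = 𝟙 _ := by
  refine L.ext_app _ (b.right_ι A ▸ P.isHomLift_right (L.lift_ι hP A)) (L.lift_id A) ?_
  have h := congrArg E.right (L.ι_appPro hP A)
  simp at h
  simp [h]

-- In the proofs below, both sides of an axiom lift the corresponding cell of `B`, by the same axiom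
-- for `b`; and they agree after composition with the Cartesian lift, by the same axiom for `e`.

lemma φ_naturality {A A' A'' D D' D'' : X.Obj} {m : X.Pro A A'} {n : X.Pro A' A''}
    {m' : X.Pro D D'} {n' : X.Pro D' D''} (θ : ProArrow.of m ⟶ ProArrow.of m')
    (κ : ProArrow.of n ⟶ ProArrow.of n') (h : X.right θ = X.left κ) :
    E.compMap (L.cell θ) (L.cell κ) (by rw [right_cell, left_cell, h]) ≫ (L.φ hP m' n').hom =
      (L.φ hP m n).hom ≫ L.cell (X.compMap θ κ h) := by
  have w : E.right (L.cell θ) = E.left (L.cell κ) := by rw [right_cell, left_cell, h]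
  have w' : B.right (b.cell θ) = B.left (b.cell κ) := by simp [h]
  have l₁ := hP.isHomLift_compMap (L.lift_cell θ) (L.lift_cell κ) w' w
  have l₂ := L.lift_φ hP m' n'
  have l₃ := L.lift_φ hP m n
  have l₄ := L.lift_cell (X.compMap θ κ h)
  refine L.ext_appPro (B.compMap (b.cell θ) (b.cell κ) w' ≫ (b.φ m' n').hom) inferInstance ?_ ?_
  · rw [b.φ_naturality θ κ h]
    infer_instance
  · have c₁ := E.compMap_comp (L.cell θ) (L.cell κ) (L.appPro m') (L.appPro n') w (by simp)
    have c₂ := E.compMap_comp (L.appPro m) (L.appPro n) (e.cell θ) (e.cell κ) (by simp)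
      (by simp [h])
    have c₃ := E.compMap_congr (by simp [w]) (L.cell_appPro θ) (L.cell_appPro κ)
    have k := L.cell_appPro (X.compMap θ κ h)
    dsimp only at k
    rw [Category.assoc, φ_appPro, Category.assoc, k, ← Category.assoc, ← c₁, c₃, c₂,
      Category.assoc, e.φ_naturality, ← Category.assoc, ← Category.assoc, φ_appPro]

lemma ι_naturality {A A' : X.Obj} (f : A ⟶ A') :
    E.unitMap (L.map f) ≫ (L.ι hP A').hom = (L.ι hP A).hom ≫ L.cell (X.unitMap f) := by
  have l₁ := hP.isHomLift_unitMap (L.lift_map f)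
  have l₂ := L.lift_ι hP A'
  have l₃ := L.lift_ι hP A
  have l₄ := L.lift_cell (X.unitMap f)
  refine L.ext_appPro (B.unitMap (b.map f) ≫ (b.ι A').hom) inferInstance ?_ ?_
  · rw [b.ι_naturality f]
    infer_instance
  · have k := L.cell_appPro (X.unitMap f)
    dsimp only at k
    rw [Category.assoc, ι_appPro, Category.assoc, k, ← Category.assoc, ← E.unitMap_comp, map_app,
      E.unitMap_comp, Category.assoc, e.ι_naturality, ← Category.assoc, ← Category.assoc, ι_appPro]

lemma associativity {A A' A'' A''' : X.Obj} (m : X.Pro A A') (n : X.Pro A' A'')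
    (q : X.Pro A'' A''') :
    E.compMap (L.φ hP m n).hom (𝟙 (ProArrow.of (L.pro q)))
        ((L.right_φ hP m n).trans (E.left_id (ProArrow.of (L.pro q))).symm) ≫
      (L.φ hP (X.comp m n) q).hom ≫ L.cell (X.assoc m n q).hom =
    (E.assoc (L.pro m) (L.pro n) (L.pro q)).hom ≫
      E.compMap (𝟙 (ProArrow.of (L.pro m))) (L.φ hP n q).hom
        ((E.right_id (ProArrow.of (L.pro m))).trans (L.left_φ hP n q).symm) ≫
      (L.φ hP m (X.comp n q)).hom := by
  have w₁ := (L.right_φ hP m n).trans (E.left_id (ProArrow.of (L.pro q))).symm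
  have w₂ := (E.right_id (ProArrow.of (L.pro m))).trans (L.left_φ hP n q).symm
  have l₁ := hP.isHomLift_compMap (L.lift_φ hP m n) (L.lift_id_pro q) (by simp) w₁
  have l₂ := L.lift_φ hP (X.comp m n) q
  have l₃ := L.lift_cell (X.assoc m n q).hom
  have l₄ := hP.isHomLift_assoc (L.pro_eq m) (L.pro_eq n) (L.pro_eq q)
  have l₅ := hP.isHomLift_compMap (L.lift_id_pro m) (L.lift_φ hP n q) (by simp) w₂
  have l₆ := L.lift_φ hP m (X.comp n q)
  refine L.ext_appPro _ (isHomLift_comp l₁ (isHomLift_comp l₂ l₃)) ?_ ?_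
  · rw [b.associativity m n q]
    exact isHomLift_comp l₄ (isHomLift_comp l₅ l₆)
  -- Both sides, composed with the lift, are rewritten by interchange until the associativity axiom
  -- of `e` applies; the naturality of the associator of `E` relates the two results.
  have k := L.cell_appPro (X.assoc m n q).hom
  dsimp only at k
  have c₁ := E.compMap_comp (L.φ hP m n).hom (𝟙 _) (L.appPro (X.comp m n)) (L.appPro q)
    w₁ (by simp)
  have c₂ := E.compMap_comp (E.compMap (L.appPro m) (L.appPro n) (by simp)) (L.appPro q)
    (e.φ m n).hom (𝟙 _) (by simp) (by simp)
  have c₃ := E.compMap_congr (by simp [w₁]) (L.φ_appPro hP m n)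
    ((Category.id_comp (L.appPro q)).trans (Category.comp_id _).symm)
  have d₁ := E.compMap_comp (𝟙 _) (L.φ hP n q).hom (L.appPro m) (L.appPro (X.comp n q))
    w₂ (by simp)
  have d₂ := E.compMap_comp (L.appPro m) (E.compMap (L.appPro n) (L.appPro q) (by simp))
    (𝟙 _) (e.φ n q).hom (by simp) (by simp)
  have d₃ := E.compMap_congr (by simp [← w₂])
    ((Category.id_comp (L.appPro m)).trans (Category.comp_id _).symm) (L.φ_appPro hP n q)
  have a := E.assoc_naturality (L.appPro m) (L.appPro n) (L.appPro q) (by simp) (by simp)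
  simp only [Category.assoc]
  rw [k, reassoc_of% (L.φ_appPro hP (X.comp m n) q), L.φ_appPro hP m (X.comp n q),
    ← Category.assoc (E.compMap _ _ _), ← c₁, c₃, c₂, Category.assoc, e.associativity,
    ← Category.assoc (E.compMap (𝟙 _) (L.φ hP n q).hom _), ← d₁, d₃, d₂, Category.assoc,
    reassoc_of% a]

lemma left_unitality {A A' : X.Obj} (m : X.Pro A A') :
    E.compMap (L.ι hP A).hom (𝟙 (ProArrow.of (L.pro m)))
        ((L.right_ι hP A).trans (E.left_id (ProArrow.of (L.pro m))).symm) ≫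
      (L.φ hP (X.unitPro A) m).hom ≫ L.cell (eqToHom (congrArg ProArrow.of (X.unit_comp m))) =
    eqToHom (congrArg ProArrow.of (E.unit_comp (L.pro m))) := by
  have w := (L.right_ι hP A).trans (E.left_id (ProArrow.of (L.pro m))).symm
  have l₁ := hP.isHomLift_compMap (L.lift_ι hP A) (L.lift_id_pro m) (by simp) w
  have l₂ := L.lift_φ hP (X.unitPro A) m
  have l₃ := L.lift_cell (eqToHom (congrArg ProArrow.of (X.unit_comp m)))
  refine L.ext_appPro _ (isHomLift_comp l₁ (isHomLift_comp l₂ l₃)) ?_ ?_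
  · rw [b.left_unitality m]
    exact isHomLift_eqToHom _ _ _ (obj_eq_of_isHomLift l₁)
  have k := L.cell_appPro (eqToHom (congrArg ProArrow.of (X.unit_comp m)))
  dsimp only at k
  have c₁ := E.compMap_comp (L.ι hP A).hom (𝟙 _) (L.appPro (X.unitPro A)) (L.appPro m)
    w (by simp)
  have c₂ := E.compMap_comp (E.unitMap (L.app A)) (L.appPro m) (e.ι A).hom (𝟙 _)
    (by simp) (by simp)
  have c₃ := E.compMap_congr (by simp [w]) (L.ι_appPro hP A)
    ((Category.id_comp (L.appPro m)).trans (Category.comp_id _).symm)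
  have c₄ := E.compMap_congr (κ := L.appPro m) (by simp)
    (congrArg (fun f => E.unitMap f) (L.left_appPro m)) rfl
  have u := E.unit_compMap (L.appPro m)
  rw [c₄] at u
  simp only [Category.assoc]
  rw [k, reassoc_of% (L.φ_appPro hP (X.unitPro A) m),
    ← Category.assoc (E.compMap _ _ _), ← c₁, c₃, c₂, Category.assoc, e.left_unitality, u]

lemma right_unitality {A A' : X.Obj} (m : X.Pro A A') :
    E.compMap (𝟙 (ProArrow.of (L.pro m))) (L.ι hP A').hom
        ((E.right_id (ProArrow.of (L.pro m))).trans (L.left_ι hP A').symm) ≫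
      (L.φ hP m (X.unitPro A')).hom ≫ L.cell (eqToHom (congrArg ProArrow.of (X.comp_unit m))) =
    eqToHom (congrArg ProArrow.of (E.comp_unit (L.pro m))) := by
  have w := (E.right_id (ProArrow.of (L.pro m))).trans (L.left_ι hP A').symm
  have l₁ := hP.isHomLift_compMap (L.lift_id_pro m) (L.lift_ι hP A') (by simp) w
  have l₂ := L.lift_φ hP m (X.unitPro A')
  have l₃ := L.lift_cell (eqToHom (congrArg ProArrow.of (X.comp_unit m)))
  refine L.ext_appPro _ (isHomLift_comp l₁ (isHomLift_comp l₂ l₃)) ?_ ?_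
  · rw [b.right_unitality m]
    exact isHomLift_eqToHom _ _ _ (obj_eq_of_isHomLift l₁)
  have k := L.cell_appPro (eqToHom (congrArg ProArrow.of (X.comp_unit m)))
  dsimp only at k
  have c₁ := E.compMap_comp (𝟙 _) (L.ι hP A').hom (L.appPro m) (L.appPro (X.unitPro A'))
    w (by simp)
  have c₂ := E.compMap_comp (L.appPro m) (E.unitMap (L.app A')) (𝟙 _) (e.ι A').hom
    (by simp) (by simp)
  have c₃ := E.compMap_congr (by simp [← w])
    ((Category.id_comp (L.appPro m)).trans (Category.comp_id _).symm) (L.ι_appPro hP A')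
  have c₄ := E.compMap_congr (θ := L.appPro m) (by simp) rfl
    (congrArg (fun f => E.unitMap f) (L.right_appPro m))
  have u := E.compMap_unit (L.appPro m)
  rw [c₄] at u
  simp only [Category.assoc]
  rw [k, reassoc_of% (L.φ_appPro hP m (X.unitPro A')),
    ← Category.assoc (E.compMap _ _ _), ← c₁, c₃, c₂, Category.assoc, e.right_unitality, u]

/-- The double functor lifting `b` whose values are the domains of the Cartesian lifts; its axioms
follow from those of `b` and `e` by the uniqueness of lifts. -/
noncomputable abbrev functor : PseudoDoubleFunctor X E where
  obj := L.obj
  map := L.map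
  map_id := L.map_id
  map_comp := L.map_comp
  pro := L.pro
  cell := L.cell
  cell_id := L.cell_id
  cell_comp := L.cell_comp
  left_cell := L.left_cell
  right_cell := L.right_cell
  φ := L.φ hP
  left_φ := L.left_φ hP
  right_φ := L.right_φ hP
  φ_naturality := L.φ_naturality hP
  ι := L.ι hP
  left_ι := L.left_ι hP
  right_ι := L.right_ι hP
  ι_naturality := L.ι_naturality hP
  associativity := L.associativity hP
  left_unitality := L.left_unitality hP
  right_unitality := L.right_unitality hP

/-- The Cartesian lifts, as a transformation. -/
def transformation : Transformation (L.functor hP) e where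
  app := L.app
  appPro := L.appPro
  left_appPro := L.left_appPro
  right_appPro := L.right_appPro
  naturality := L.map_app
  naturality_cell := L.cell_appPro
  unit A := (L.ι_appPro hP A).symm
  comp m n := (L.φ_appPro hP m n).symm

lemma functor_comp : (L.functor hP).comp P = b :=
  hP.comp_eq_of_isHomLift L.lift_map L.lift_cell (L.lift_φ hP) (L.lift_ι hP)

end CartesianLifts

/-! ### Double fibrations are internal fibrations -/

lemma Cleavage.Chosen.exists_eq {𝒳 𝒮 : Type*} [Category* 𝒳] [Category* 𝒮] {p : 𝒳 ⥤ 𝒮}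
    {c : Cleavage p} {x y : 𝒳} {f : x ⟶ y} (hf : c.Chosen f) {b : 𝒮} (w : b ⟶ p.obj y)
    (h : p.IsHomLift w f) : ∃ e : x = c.obj w, f = eqToHom e ≫ c.map w := by
  obtain ⟨u⟩ := hf
  have hu := (c.isStronglyCartesian u).toIsHomLift
  obtain rfl := (obj_eq_of_isHomLift hu).symm.trans (obj_eq_of_isHomLift h)
  obtain rfl : u = w := by
    have e := (IsHomLift.fac p u (c.map u)).trans (IsHomLift.fac p w (c.map u)).symm
    exact e
  exact ⟨rfl, (Category.id_comp _).symm⟩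

/-- Every cell into the image of a proarrow `M` has a Cartesian lift whose source and target are
prescribed arrows of the cleavage of `P₀`. -/
lemma exists_cartesian_cell {E B : Dbl.{v, u}} {P : PseudoDoubleFunctor E B}
    {c₀ : Cleavage P.objFunctor} {c₁ : Cleavage P.arrFunctor}
    (hs : PreservesCleavage c₁ c₀ E.srcFunctor) (ht : PreservesCleavage c₁ c₀ E.tgtFunctor)
    {A A' : E.Obj} (M : E.Pro A A') {m : B.Arr} (w : m ⟶ ProArrow.of (P.pro M))
    {f : m.src ⟶ P.obj A} {g : m.tgt ⟶ P.obj A'} (hf : B.left w = f) (hg : B.right w = g) :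
    ∃ (N : E.Pro (c₀.obj (p := P.objFunctor) f) (c₀.obj (p := P.objFunctor) g))
      (θ : ProArrow.of N ⟶ ProArrow.of M),
      E.left θ = c₀.map f ∧ E.right θ = c₀.map g ∧ P.arrFunctor.IsHomLift w θ ∧
        IsCartesianArrow P.arrFunctor θ := by
  subst hf hg
  let w' : m ⟶ P.arrFunctor.obj (ProArrow.of M) := w
  have hc := c₁.isStronglyCartesian w'
  have h₁ : P.arrFunctor.IsHomLift w (c₁.map w') := hc.toIsHomLift
  obtain ⟨e, he⟩ := (hs _ (.lift w')).exists_eq (B.left w) (P.isHomLift_left h₁)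
  obtain ⟨e', he'⟩ := (ht _ (.lift w')).exists_eq (B.right w) (P.isHomLift_right h₁)
  have h₂ : IsCartesianArrow P.arrFunctor (c₁.map w') := .of_isStronglyCartesian w'
  generalize c₁.map w' = θ at *
  generalize c₁.obj w' = N at *
  obtain ⟨S, T, N⟩ := N
  change S = c₀.obj (p := P.objFunctor) (B.left w) at e
  change T = c₀.obj (p := P.objFunctor) (B.right w) at e'
  subst e e'
  exact ⟨N, θ, he.trans (Category.id_comp _), he'.trans (Category.id_comp _), h₁, h₂⟩

/-- The compatible cleavages provide Cartesian lifts of the components of any transformation. -/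
lemma DefinesDoubleFibration.nonempty_cartesianLifts {X E B : Dbl.{v, u}}
    {P : PseudoDoubleFunctor E B} (h : DefinesDoubleFibration P) (e : PseudoDoubleFunctor X E)
    {b : PseudoDoubleFunctor X B} (β : Transformation b (e.comp P)) :
    Nonempty (CartesianLifts P e β) := by
  obtain ⟨c₀, c₁, hs, ht⟩ := h.exists_cleavages
  have cart : ∀ A, IsCartesianArrow P.objFunctor (c₀.map (p := P.objFunctor) (β.app A)) :=
    fun A => .of_isStronglyCartesian (p := P.objFunctor) (β.app A)
      (h := c₀.isStronglyCartesian (p := P.objFunctor) (β.app A))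
  choose pro appPro hl hr hw hc using fun {A A' : X.Obj} (m : X.Pro A A') =>
    exists_cartesian_cell hs ht (e.pro m) (β.appPro m) (β.left_appPro m) (β.right_appPro m)
  exact ⟨{
    obj A := c₀.obj (p := P.objFunctor) (β.app A)
    app A := c₀.map (p := P.objFunctor) (β.app A)
    pro := pro
    appPro := appPro
    left_appPro := hl
    right_appPro := hr
    lift_app A := (c₀.isStronglyCartesian (p := P.objFunctor) (β.app A)).toIsHomLift
    lift_appPro := hw
    cart_app := cart
    cart_appPro := hc
    cart_unit A := h.unit_cartesian _ (cart A)
    cart_comp {A A' A''} m n := by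
      let x : E.Pair := ⟨pro m, pro n⟩
      let y : E.Pair := ⟨e.pro m, e.pro n⟩
      let f : x ⟶ y := Dbl.Pair.Hom.mk (appPro m) (appPro n) ((hr m).trans (hl n).symm)
      refine h.comp_cartesian f (P.isCartesianArrow_pair f (hc m) (hc n) ?_)
      change IsCartesianArrow P.objFunctor (E.right (appPro m))
      rw [hr]
      exact cart A' }⟩

/-- Cartesian lifts of the components of `β` assemble to a Cartesian lift of `β`. -/
theorem isInternalFibration_of_definesDoubleFibration {E B : Dbl.{v, u}} (P : E ⟶ B)
    (hP : PseudoDoubleFunctor.IsStrict P) (h : DefinesDoubleFibration P) :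
    IsInternalFibration P := by
  intro X e b β
  obtain ⟨L⟩ := h.nonempty_cartesianLifts e β
  refine ⟨L.functor hP, L.transformation hP, L.functor_comp hP, ?_, ?_⟩
  · refine Transformation.hom_ext (fun A => ?_) (fun m => ?_)
    · rw [Transformation.comp_app, Transformation.eqToHom_app]
      have := L.lift_app A
      exact (IsHomLift.fac' (PseudoDoubleFunctor.objFunctor P) (β.app A) (L.app A)).trans
        (congrArg (_ ≫ ·) (Category.comp_id _))
    · rw [Transformation.comp_appPro, Transformation.eqToHom_appPro]
      have := L.lift_appPro m
      exact (IsHomLift.fac' (PseudoDoubleFunctor.arrFunctor P) (β.appPro m) (L.appPro m)).trans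
        (congrArg (_ ≫ ·) (Category.comp_id _))
  · intro Y
    exact existsUnique_lift_of_isCartesianArrow (L.transformation hP) L.cart_app L.cart_appPro

end DblFib

theorem mainTheorem3 {E B : DblFib.Dbl.{v, max v u}} (P : E ⟶ B)
    (hP : DblFib.PseudoDoubleFunctor.IsStrict P) :
    DblFib.DefinesDoubleFibration P ↔ DblFib.IsInternalFibration P :=
  ⟨DblFib.isInternalFibration_of_definesDoubleFibration P hP,
    DblFib.definesDoubleFibration_of_isInternalFibration P⟩
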